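/- Let $A\in GL(k,\mathbb{Z})$ have real eigenvalues $B_1,\dots,B_k$ with $$|B_1|<\cdots<|B_j|<1<|B_{j+1}|<\cdots<|B_k|,$$ and let $v_1,\dots,v_k$ be corresponding eigenvectors, forming a basis of $\mathbb{R}^k$. For $0<\lambda<1$ and $p\in C^{k+1}(\mathbb{T}^k,\mathbb{R})$, $\mathbb{T}^k=\mathbb{R}^k/\mathbb{Z}^k$, put $$\phi(x)=\sum_{n=0}^{\infty}\lambda^n p(A^{-n}x),\qquad x\in\mathbb{T}^k,$$ and for a point $x\in\mathbb{T}^k$ and $1\le i\le k$ let $\phi_i(t)=\phi(tv_i+x)$, $t\in[-\varepsilon,\varepsilon]$, where $\varepsilon>0$; the graphs of the functions $\phi_i$ in the Euclidean plane are the sub-slices of the graph of $\phi$ at $x$. Then for generic $p$ the following holds, where generic means: for all $p$ in a suitable open and dense subset of $C^{k+1}(\mathbb{T}^k,\mathbb{R})$, in the $C^{k+1}$ topology, which does not depend on $\lambda$, $l$, $x$, $\varepsilon$. For every $0\le l\le j$, every $\lambda\in(|B_l|,|B_{l+1}|)\cap(0,1)$ (with $|B_0|:=0$), every $x\in\mathbb{T}^k$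 and every $\varepsilon>0$, the graph of each $\phi_i$ has a box dimension (its lower and upper box dimensions agree), and $$\sum_{i=1}^{k}\dim(\mathrm{graph}(\phi_i))=(k-l)+2l-\sum_{i=1}^{l}\frac{\log\lambda}{\log|B_i|}.$$ -/

import Mathlib

open Set Filter Topology
open scoped Matrix

namespace SkewGraph

noncomputable section

/-- The smallest number of sets of diameter at most `δ` whose union covers `X`. -/
def coverNumber {M : Type*} [MetricSpace M] (X : Set M) (δ : ℝ) : ℕ :=
  sInf {n : ℕ | ∃ 𝒰 : Finset (Set M), 𝒰.card = n ∧
    (∀ U ∈ 𝒰, Metric.ediam U ≤ ENNReal.ofReal δ) ∧ X ⊆ ⋃ U ∈ 𝒰, U}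

/-- The lower box dimension of `X` (for `X` non-empty and totally bounded). -/
def lowerBoxDim {M : Type*} [MetricSpace M] (X : Set M) : EReal :=
  liminf (fun δ : ℝ => ((Real.log (coverNumber X δ) / (-Real.log δ) : ℝ) : EReal)) (𝓝[>] 0)

/-- The upper box dimension of `X` (for `X` non-empty and totally bounded). -/
def upperBoxDim {M : Type*} [MetricSpace M] (X : Set M) : EReal :=
  limsup (fun δ : ℝ => ((Real.log (coverNumber X δ) / (-Real.log δ) : ℝ) : EReal)) (𝓝[>] 0)

/-- The set `X` is non-empty and totally bounded, its lower and upper box dimensions agree, and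
their common value, the box dimension of `X`, is `d`. -/
def HasBoxDim {M : Type*} [MetricSpace M] (X : Set M) (d : ℝ) : Prop :=
  X.Nonempty ∧ TotallyBounded X ∧ lowerBoxDim X = (d : EReal) ∧ upperBoxDim X = (d : EReal)

/-- The graph of `f` over `S`, as a subset of the Euclidean plane. -/
def planeGraph (S : Set ℝ) (f : ℝ → ℝ) : Set (EuclideanSpace ℝ (Fin 2)) :=
  (fun t => !₂[t, f t]) '' S

/-- The projection `ℝᵏ → 𝕋ᵏ = (ℝ/ℤ)ᵏ`. -/
def toTorus {k : ℕ} (x : Fin k → ℝ) : UnitAddTorus (Fin k) :=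
  fun i => (x i : UnitAddCircle)

/-- The self-map of `𝕋ᵏ` induced by an integer matrix. -/
def torusEnd {k : ℕ} (M : Matrix (Fin k) (Fin k) ℤ) (x : UnitAddTorus (Fin k)) :
    UnitAddTorus (Fin k) :=
  fun i => ∑ j, M i j • x j

/-- The space `Cʳ(𝕋ᵏ, ℝ)`: the functions on the torus whose lift to `ℝᵏ` is of class `Cʳ`. -/
def CrTorus (k r : ℕ) : Type :=
  {p : UnitAddTorus (Fin k) → ℝ // ContDiff ℝ r (fun x : Fin k → ℝ => p (toTorus x))}

/-- The `Cʳ` topology: uniform convergence of all derivatives of order at most `r`. -/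
instance CrTorus.instTopologicalSpace (k r : ℕ) : TopologicalSpace (CrTorus k r) :=
  ⨅ m : Fin (r + 1), TopologicalSpace.induced
    (fun p : CrTorus k r =>
      UniformFun.ofFun (iteratedFDeriv ℝ (m : ℕ) (fun x : Fin k → ℝ => p.1 (toTorus x))))
    inferInstance

/-- The function `φ(x) = ∑_{n ≥ 0} λⁿ p(A⁻ⁿ x)` on the torus. -/
def phi {k : ℕ} (A : Matrix.GeneralLinearGroup (Fin k) ℤ) (lam : ℝ)
    (p : UnitAddTorus (Fin k) → ℝ) (x : UnitAddTorus (Fin k)) : ℝ :=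
  ∑' n : ℕ, lam ^ n * p (torusEnd ((A⁻¹ ^ n : Matrix.GeneralLinearGroup (Fin k) ℤ) :
    Matrix (Fin k) (Fin k) ℤ) x)

/-- The restriction `t ↦ φ(t w + x)` of `φ` to the line through `x` with direction `w`. -/
def subSlice {k : ℕ} (A : Matrix.GeneralLinearGroup (Fin k) ℤ) (lam : ℝ)
    (p : UnitAddTorus (Fin k) → ℝ) (x : UnitAddTorus (Fin k)) (w : Fin k → ℝ) (t : ℝ) : ℝ :=
  phi A lam p (toTorus (t • w) + x)

end

end SkewGraph

namespace SkewGraph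

/-! ### Box dimension from two-sided covering bounds. -/

section BoxDim

variable {M : Type*} [MetricSpace M]

/-! Each sub-slice is treated on its own. Let `v` be an eigenvector with eigenvalue `b`. If `lam <
|b|`, the increments of the series along `v` are dominated by a geometric series of ratio `lam /
|b|`, so the slice is Lipschitz and its graph has dimension 1.

If `|b| < lam`, extend the series of increments to all integers: F(x,t) = ∑_{n∈ℤ} λⁿ (p(A⁻ⁿ(x+tv)) −
p(A⁻ⁿx)) (`twoSided`). The added terms, those with n < 0, are Lipschitz in t, while F itself is
exactly self-similar (`twoSided_scale`) and a cocycle in t (`twoSided_cocycle`). Put α = log λ / log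
|b| ∈ (0,1), so that |b|^α = λ. Scaling gives |F(x,t)| ≤ C|t|^α. If no F(x,·) vanishes identically,
compactness of the torus and scaling also give oscillation at least cδ^α at every point and every
small scale δ. The Lipschitz error is negligible against δ^α, so the slice is α-Hölder with matching
oscillation, and box counting yields dimension 2 − α (`hasBoxDim_planeGraph_of_holder`).

Everything thus rests on F(x,·) ≢ 0 for all x and λ simultaneously. Expanding p in a Fourier series
turns differences of F(x,·) into absolutely convergent almost periodic series. If F(x,·) vanished,
each frequency would have total coefficient zero. The frequency ⟨ξ₀,v⟩ collects ξ₀ and those ξ with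
⟨ξ,v⟩ = bⁿ⟨ξ₀,v⟩, the latter weighted by λⁿ ≤ 1 + |b|ⁿ. So it suffices that the coefficient at ξ₀
outweighs the rest of its orbit in a weighted sum free of λ and x
(`HasFourier.exists_twoSided_ne_zero`); this condition defines `dominatedSet`.

The condition is open because the weights grow at most linearly in ξ and Cᵏ⁺¹ embeds in the Fourier
algebra with weight 1 + ‖ξ‖ (`summable_weighted_mFourierCoeff`). It is dense because averaging p
over finitely many tiny translates annihilates all coefficients on one well-chosen orbit
(`exists_odd_dotProduct`, `coeff_average`), after which a small multiple of a cosine makes ξ₀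
dominant. The generic set is the intersection over the contracting directions. -/

lemma exists_cover_of_totallyBounded {X : Set M} (hX : TotallyBounded X) {δ : ℝ} (hδ : 0 < δ) :
    ∃ 𝒰 : Finset (Set M), (∀ U ∈ 𝒰, Metric.ediam U ≤ ENNReal.ofReal δ) ∧ X ⊆ ⋃ U ∈ 𝒰, U := by
  classical
  obtain ⟨t, ht, hXt⟩ := Metric.totallyBounded_iff.1 hX (δ / 2) (by positivity)
  refine ⟨ht.toFinset.image (fun y => Metric.ball y (δ / 2)), ?_, ?_⟩
  · intro U hU
    obtain ⟨y, -, rfl⟩ := Finset.mem_image.1 hU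
    refine Metric.ediam_le fun a ha b hb => ?_
    rw [edist_dist]
    refine ENNReal.ofReal_le_ofReal ?_
    have h1 := Metric.mem_ball.1 ha
    have h2 := Metric.mem_ball'.1 hb
    linarith [dist_triangle a y b]
  · intro x hx
    obtain ⟨y, hy, hxy⟩ := mem_iUnion₂.1 (hXt hx)
    refine mem_iUnion₂.2 ⟨_, Finset.mem_image.2 ⟨y, ht.mem_toFinset.2 hy, rfl⟩, hxy⟩

lemma coverNumber_le {ι : Type*} {X : Set M} {δ : ℝ} (s : Finset ι) (U : ι → Set M)
    (hU : ∀ i ∈ s, Metric.ediam (U i) ≤ ENNReal.ofReal δ) (hX : X ⊆ ⋃ i ∈ s, U i) :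
    coverNumber X δ ≤ s.card := by
  classical
  refine le_trans (Nat.sInf_le ⟨s.image U, rfl, ?_, ?_⟩) Finset.card_image_le
  · intro V hV
    obtain ⟨i, hi, rfl⟩ := Finset.mem_image.1 hV
    exact hU i hi
  · intro x hx
    obtain ⟨i, hi, hxi⟩ := mem_iUnion₂.1 (hX hx)
    exact mem_iUnion₂.2 ⟨_, Finset.mem_image_of_mem U hi, hxi⟩

/-- A set of diameter at most `δ` contains at most one of the separated points. Total boundedness is
needed because `sInf ∅ = 0`: without any finite cover the covering number would be 0. -/
lemma card_le_coverNumber {ι : Type*} {X : Set M} (hX : TotallyBounded X) {δ : ℝ} (hδ : 0 < δ)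
    (s : Finset ι) (g : ι → M) (hg : ∀ i ∈ s, g i ∈ X)
    (hsep : ∀ i ∈ s, ∀ j ∈ s, i ≠ j → δ < dist (g i) (g j)) :
    s.card ≤ coverNumber X δ := by
  classical
  obtain ⟨𝒱, h1, h2⟩ := exists_cover_of_totallyBounded hX hδ
  refine le_csInf ⟨_, 𝒱, rfl, h1, h2⟩ ?_
  rintro n ⟨𝒰, rfl, hd, hc⟩
  have hc' : ∀ i ∈ s, ∃ U ∈ 𝒰, g i ∈ U := fun i hi => by simpa using hc (hg i hi)
  choose! F hF hgF using hc'
  refine Finset.card_le_card_of_injOn F hF ?_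
  intro i hi j hj hij
  by_contra hne
  have h3 := hsep i hi j hj hne
  have h4 : edist (g i) (g j) ≤ ENNReal.ofReal δ :=
    (Metric.edist_le_ediam_of_mem (hgF i hi) (by rw [hij]; exact hgF j hj)).trans (hd _ (hF i hi))
  rw [edist_dist, ENNReal.ofReal_le_ofReal_iff hδ.le] at h4
  linarith

/-- After division by `-log δ → ∞` the multiplicative constants disappear. -/
lemma hasBoxDim_of_coverNumber_bounds {X : Set M} (hne : X.Nonempty) (hX : TotallyBounded X)
    {d c C r : ℝ} (hc : 0 < c) (hC : 0 < C) (hr : 0 < r)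
    (hlow : ∀ δ, 0 < δ → δ < r → c * δ ^ (-d) ≤ coverNumber X δ)
    (hup : ∀ δ, 0 < δ → δ < r → coverNumber X δ ≤ C * δ ^ (-d)) : HasBoxDim X d := by
  have hlog : Tendsto (fun δ : ℝ => -Real.log δ) (𝓝[>] 0) atTop :=
    tendsto_neg_atBot_atTop.comp Real.tendsto_log_nhdsGT_zero
  have hlim : ∀ a : ℝ, Tendsto (fun δ : ℝ => a / (-Real.log δ) + d) (𝓝[>] 0) (𝓝 d) := by
    intro a
    simpa using (hlog.const_div_atTop a).add_const d
  have hsmall : ∀ᶠ δ : ℝ in 𝓝[>] 0, 0 < δ ∧ δ < r ∧ δ < 1 := by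
    filter_upwards [self_mem_nhdsWithin,
      nhdsWithin_le_nhds (Iio_mem_nhds hr), nhdsWithin_le_nhds (Iio_mem_nhds one_pos)] with δ h1 h2 h3
    exact ⟨h1, h2, h3⟩
  have key : ∀ a δ : ℝ, 0 < a → 0 < δ → δ < 1 →
      Real.log (a * δ ^ (-d)) / (-Real.log δ) = Real.log a / (-Real.log δ) + d := by
    intro a δ ha h0 h1
    have hl : Real.log δ < 0 := Real.log_neg h0 h1
    rw [Real.log_mul ha.ne' (Real.rpow_pos_of_pos h0 _).ne', Real.log_rpow h0]
    have hl' : -Real.log δ ≠ 0 := by linarith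
    rw [add_div, neg_mul, ← mul_neg, mul_div_assoc, div_self hl', mul_one]
  have hT : Tendsto (fun δ : ℝ => Real.log (coverNumber X δ) / (-Real.log δ)) (𝓝[>] 0) (𝓝 d) := by
    refine tendsto_of_tendsto_of_tendsto_of_le_of_le' (hlim (Real.log c)) (hlim (Real.log C)) ?_ ?_
    · filter_upwards [hsmall] with δ h
      rw [← key c δ hc h.1 h.2.2]
      have hl : Real.log δ < 0 := Real.log_neg h.1 h.2.2
      have := Real.rpow_pos_of_pos h.1 (-d)
      exact div_le_div_of_nonneg_right
        (Real.log_le_log (by positivity) (hlow δ h.1 h.2.1)) (by linarith)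
    · filter_upwards [hsmall] with δ h
      rw [← key C δ hC h.1 h.2.2]
      have hl : Real.log δ < 0 := Real.log_neg h.1 h.2.2
      have := Real.rpow_pos_of_pos h.1 (-d)
      have hpos : (0 : ℝ) < coverNumber X δ :=
        lt_of_lt_of_le (by positivity) (hlow δ h.1 h.2.1)
      exact div_le_div_of_nonneg_right
        (Real.log_le_log hpos (hup δ h.1 h.2.1)) (by linarith)
  have hT' := (continuous_coe_real_ereal.tendsto d).comp hT
  exact ⟨hne, hX, hT'.liminf_eq, hT'.limsup_eq⟩

end BoxDim

/-! ### Box counting for graphs in the plane. -/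

section Graph

lemma abs_sub_le_dist_plane (a b a' b' : ℝ) :
    |a - a'| ≤ dist (!₂[a, b] : EuclideanSpace ℝ (Fin 2)) !₂[a', b'] ∧
    |b - b'| ≤ dist (!₂[a, b] : EuclideanSpace ℝ (Fin 2)) !₂[a', b'] := by
  rw [EuclideanSpace.dist_eq]
  simp only [Fin.sum_univ_two, Real.dist_eq, sq_abs]
  constructor
  · apply Real.abs_le_sqrt
    simpa using sq_nonneg (b - b')
  · apply Real.abs_le_sqrt
    simpa using sq_nonneg (a - a')

lemma dist_plane_le (P Q : EuclideanSpace ℝ (Fin 2)) :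
    dist P Q ≤ |P 0 - Q 0| + |P 1 - Q 1| := by
  rw [EuclideanSpace.dist_eq]
  simp only [Fin.sum_univ_two, Real.dist_eq]
  apply Real.sqrt_le_iff.2
  constructor
  · positivity
  · nlinarith [abs_nonneg (P 0 - Q 0), abs_nonneg (P 1 - Q 1)]

lemma planeGraph_nonempty {ε : ℝ} (hε : 0 < ε) (f : ℝ → ℝ) :
    (planeGraph (Icc (-ε) ε) f).Nonempty :=
  ⟨_, mem_image_of_mem _ (⟨by linarith, by linarith⟩ : (0 : ℝ) ∈ Icc (-ε) ε)⟩

lemma planeGraph_totallyBounded (ε : ℝ) {f : ℝ → ℝ} (hf : Continuous f) :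
    TotallyBounded (planeGraph (Icc (-ε) ε) f) := by
  refine (isCompact_Icc.image ?_).totallyBounded
  refine (PiLp.continuous_toLp 2 _).comp ?_
  refine continuous_pi fun i => ?_
  fin_cases i
  · exact continuous_id
  · exact hf

/-- Cut the interval into about 1/r columns of width r. In each, the graph stays within C·r^α of its
value at the left end, hence meets only O(r^(α-1)) squares of side r. -/
lemma coverNumber_planeGraph_le {ε : ℝ} (hε : 0 < ε) {f : ℝ → ℝ} {α C : ℝ} (hα1 : α ≤ 1)
    (hC : 0 ≤ C) (hf : ∀ s t, |s - t| ≤ 1 → |f s - f t| ≤ C * |s - t| ^ α) (hα0 : 0 < α)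
    {δ : ℝ} (hδ : 0 < δ) (hδ1 : δ < 1) :
    (coverNumber (planeGraph (Icc (-ε) ε) f) δ : ℝ) ≤
      (2 * ε + 1) * (2 * C + 5) * 4 * δ ^ (-(2 - α)) := by
  -- A square of side δ/2 has ℓ¹-diameter δ, which bounds its Euclidean diameter.
  set r := δ / 2 with hr
  have hr0 : 0 < r := by positivity
  have hr1 : r < 1 := by linarith
  set K : ℕ := ⌈C * r ^ (α - 1)⌉₊ with hK
  set N : ℕ := ⌊2 * ε / r⌋₊ + 1 with hN
  let U : ℕ × ℤ → Set (EuclideanSpace ℝ (Fin 2)) := fun q =>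
    {P | (-ε + q.1 * r ≤ P 0 ∧ P 0 ≤ -ε + (q.1 + 1) * r) ∧
      (f (-ε + q.1 * r) + q.2 * r ≤ P 1 ∧ P 1 ≤ f (-ε + q.1 * r) + (q.2 + 1) * r)}
  have hcov := coverNumber_le (X := planeGraph (Icc (-ε) ε) f) (δ := δ)
    (Finset.range N ×ˢ Finset.Icc (-(K : ℤ)) K) U ?_ ?_
  · have hcard : ((Finset.range N ×ˢ Finset.Icc (-(K : ℤ)) K).card : ℝ) = N * (2 * K + 1) := by
      rw [Finset.card_product, Finset.card_range, Int.card_Icc]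
      have : ((K : ℤ) + 1 - -(K : ℤ)).toNat = 2 * K + 1 := by omega
      rw [this]; push_cast; ring
    have h1 : (N : ℝ) ≤ (2 * ε + 1) * r⁻¹ := by
      have h2 : (⌊2 * ε / r⌋₊ : ℝ) ≤ 2 * ε * r⁻¹ :=
        (Nat.floor_le (by positivity)).trans_eq (div_eq_mul_inv _ _)
      have h3 : 1 ≤ r⁻¹ := (one_le_inv₀ hr0).2 hr1.le
      rw [hN]; push_cast
      linarith
    have h4 : (2 * K + 1 : ℝ) ≤ (2 * C + 5) * r ^ (α - 1) := by
      have h5 : (K : ℝ) < C * r ^ (α - 1) + 1 := Nat.ceil_lt_add_one (by positivity)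
      have h6 : 1 ≤ r ^ (α - 1) := Real.one_le_rpow_of_pos_of_le_one_of_nonpos hr0 hr1.le (by linarith)
      nlinarith
    have h7 : r⁻¹ * r ^ (α - 1) ≤ 4 * δ ^ (-(2 - α)) := by
      rw [← Real.rpow_neg_one r, ← Real.rpow_add hr0]
      rw [hr, Real.div_rpow hδ.le (by norm_num)]
      have h8 : (-1 + (α - 1) : ℝ) = -(2 - α) := by ring
      rw [h8, Real.rpow_neg (by norm_num : (0 : ℝ) ≤ 2), div_inv_eq_mul, mul_comm]
      refine mul_le_mul_of_nonneg_right ?_ (by positivity)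
      calc (2 : ℝ) ^ (2 - α) ≤ 2 ^ (2 : ℝ) :=
            Real.rpow_le_rpow_of_exponent_le (by norm_num) (by linarith)
        _ = 4 := by norm_num
    calc (coverNumber (planeGraph (Icc (-ε) ε) f) δ : ℝ)
        ≤ N * (2 * K + 1) := by rw [← hcard]; exact_mod_cast hcov
      _ ≤ ((2 * ε + 1) * r⁻¹) * ((2 * C + 5) * r ^ (α - 1)) := by gcongr
      _ = (2 * ε + 1) * (2 * C + 5) * (r⁻¹ * r ^ (α - 1)) := by ring
      _ ≤ (2 * ε + 1) * (2 * C + 5) * (4 * δ ^ (-(2 - α))) := by gcongr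
      _ = _ := by ring
  · intro q _
    refine Metric.ediam_le fun P hP Q hQ => ?_
    rw [edist_dist]
    refine ENNReal.ofReal_le_ofReal ((dist_plane_le P Q).trans ?_)
    have h1 : |P 0 - Q 0| ≤ r := abs_sub_le_iff.2 ⟨by linarith [hP.1.2, hQ.1.1], by
      linarith [hP.1.1, hQ.1.2]⟩
    have h2 : |P 1 - Q 1| ≤ r := abs_sub_le_iff.2 ⟨by linarith [hP.2.2, hQ.2.1], by
      linarith [hP.2.1, hQ.2.2]⟩
    linarith
  · rintro _ ⟨t, ht, rfl⟩
    set a : ℕ := ⌊(t + ε) / r⌋₊ with ha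
    have hta : 0 ≤ (t + ε) / r := div_nonneg (by linarith [ht.1]) hr0.le
    have ha1 : a * r ≤ t + ε := by
      have := Nat.floor_le hta
      rwa [le_div_iff₀ hr0] at this
    have ha2 : t + ε ≤ (a + 1) * r := by
      have := (Nat.lt_floor_add_one ((t + ε) / r)).le
      rwa [div_le_iff₀ hr0] at this
    set y := f (-ε + a * r) with hy
    set b : ℤ := ⌊(f t - y) / r⌋ with hb
    have hb1 : b * r ≤ f t - y := by
      have := Int.floor_le ((f t - y) / r)
      rwa [le_div_iff₀ hr0] at this
    have hb2 : f t - y ≤ (b + 1) * r := by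
      have := (Int.lt_floor_add_one ((f t - y) / r)).le
      rwa [div_le_iff₀ hr0] at this
    have hd : |t - (-ε + a * r)| ≤ r := abs_sub_le_iff.2 ⟨by linarith, by linarith⟩
    have hfd : |f t - y| ≤ C * r ^ α :=
      (hf t (-ε + a * r) (by linarith)).trans (by gcongr)
    have hfd' : |(f t - y) / r| ≤ K := by
      rw [abs_div, abs_of_pos hr0, div_le_iff₀ hr0]
      refine hfd.trans ?_
      calc C * r ^ α = C * r ^ (α - 1) * r := by
            rw [Real.rpow_sub_one hr0.ne']; field_simp
        _ ≤ K * r := by gcongr; exact Nat.le_ceil _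
    rw [abs_le] at hfd'
    refine mem_iUnion₂.2 ⟨(a, b), ?_, ?_⟩
    · rw [Finset.mem_product, Finset.mem_range, Finset.mem_Icc]
      refine ⟨?_, ?_, ?_⟩
      · rw [hN, Nat.lt_succ_iff]
        apply Nat.floor_mono
        gcongr
        linarith [ht.2]
      · rw [Int.le_floor]; push_cast; exact hfd'.1
      · have h9 : (b : ℝ) ≤ K := (Int.floor_le _).trans hfd'.2
        exact_mod_cast h9
    · refine ⟨⟨?_, ?_⟩, ?_, ?_⟩ <;> simp <;> linarith

lemma le_coverNumber_planeGraph_of_one {ε : ℝ} {f : ℝ → ℝ} (hf : Continuous f)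
    {δ : ℝ} (hδ : 0 < δ) (hδε : δ < ε / 4) :
    ε / 4 * δ ^ (-1 : ℝ) ≤ coverNumber (planeGraph (Icc (-ε) ε) f) δ := by
  have hε : 0 < ε := by linarith
  have h := card_le_coverNumber (planeGraph_totallyBounded ε hf) hδ
    (Finset.range ⌊ε / (2 * δ)⌋₊) (fun j : ℕ => !₂[-ε + 4 * δ * j, f (-ε + 4 * δ * j)]) ?_ ?_
  · rw [Finset.card_range] at h
    have h1 := Nat.lt_floor_add_one (ε / (2 * δ))
    have h2 : (1 : ℝ) ≤ ε / (4 * δ) := by rw [le_div_iff₀ (by positivity)]; linarith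
    have h3 : ε / (2 * δ) = 2 * (ε / (4 * δ)) := by field_simp; norm_num
    have h4 : ε / 4 * δ ^ (-1 : ℝ) = ε / (4 * δ) := by rw [Real.rpow_neg_one]; field_simp
    rw [h4]
    have h5 : (⌊ε / (2 * δ)⌋₊ : ℝ) ≤ coverNumber (planeGraph (Icc (-ε) ε) f) δ := by exact_mod_cast h
    linarith
  · intro j hj
    refine mem_image_of_mem _ ⟨by nlinarith [(Nat.cast_nonneg j : (0 : ℝ) ≤ j)], ?_⟩
    have h1 : (j : ℝ) ≤ ε / (2 * δ) :=
      (Nat.le_floor_iff (by positivity)).1 (Finset.mem_range.1 hj).le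
    rw [le_div_iff₀ (by positivity)] at h1
    linarith
  · intro i _ j _ hij
    refine lt_of_lt_of_le ?_ (abs_sub_le_dist_plane _ _ _ _).1
    have h1 : (1 : ℝ) ≤ |(i : ℝ) - j| := by
      have : (1 : ℤ) ≤ |(i : ℤ) - j| := Int.one_le_abs (by omega)
      exact_mod_cast this
    rw [show -ε + 4 * δ * i - (-ε + 4 * δ * j) = 4 * δ * ((i : ℝ) - j) by ring, abs_mul,
      abs_of_pos (by positivity)]
    nlinarith

/-- In each of about ε/(2δ) disjoint windows the function climbs or falls by at least c·δ^α, so the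
intermediate value theorem supplies about c·δ^(α-1)/2 graph points at heights 2δ apart. Multiplying
gives a δ-separated set of the required size. -/
lemma le_coverNumber_planeGraph {ε : ℝ} {f : ℝ → ℝ} (hf : Continuous f) {α c : ℝ} (hc : 0 < c)
    {δ : ℝ} (hδ : 0 < δ) (hδε : δ < ε / 4)
    (hosc : ∀ s, ∃ t, |t - s| ≤ δ ∧ c * δ ^ α ≤ |f t - f s|) :
    ε * c / 8 * δ ^ (-(2 - α)) ≤ coverNumber (planeGraph (Icc (-ε) ε) f) δ := by
  have hε : 0 < ε := by linarith
  set J : ℕ := ⌊ε / (2 * δ)⌋₊ with hJ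
  set L : ℕ := ⌊c * δ ^ (α - 1) / 2⌋₊ + 1 with hL
  -- Window centres: the offset δ keeps the first window inside `[-ε, ε]`, and spacing 4δ leaves a
  -- gap of 2δ between windows of radius δ.
  let s : ℕ → ℝ := fun j => -ε + δ + 4 * δ * j
  -- The second coordinate is the direction of the oscillation. It is tied to the point chosen from
  -- `hosc (s q.1)`, so it is the same for all levels in one window and the heights stay
  -- 2δ-separated.
  have hpt : ∀ q : ℕ × ℕ, ∃ z : ℝ × ℝ, q.2 < L →
      |z.1 - s q.1| ≤ δ ∧ f z.1 = f (s q.1) + z.2 * (2 * δ * q.2) ∧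
      z.2 = if f (s q.1) ≤ f ((hosc (s q.1)).choose) then 1 else -1 := by
    rintro ⟨j, l⟩
    by_cases hl : l < L
    swap
    · exact ⟨0, fun h => absurd h hl⟩
    obtain ⟨ht1, ht2⟩ := (hosc (s j)).choose_spec
    set t := (hosc (s j)).choose
    have hh : 2 * δ * l ≤ |f t - f (s j)| := by
      refine le_trans ?_ ht2
      have h1 : (l : ℝ) ≤ c * δ ^ (α - 1) / 2 :=
        (Nat.le_floor_iff (by positivity)).1 (Nat.lt_succ_iff.1 hl)
      calc 2 * δ * l ≤ 2 * δ * (c * δ ^ (α - 1) / 2) := by gcongr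
        _ = c * δ ^ α := by rw [Real.rpow_sub_one hδ.ne']; field_simp
    have h0 : 0 ≤ 2 * δ * l := by positivity
    have hiv := intermediate_value_uIcc (hf.continuousOn (s := uIcc (s j) t))
    have hsub : ∀ u ∈ uIcc (s j) t, |u - s j| ≤ δ := fun u hu =>
      (abs_sub_left_of_mem_uIcc hu).trans ht1
    by_cases hle : f (s j) ≤ f t
    · rw [abs_of_nonneg (by linarith)] at hh
      obtain ⟨u, hu, hfu⟩ := hiv (show f (s j) + 2 * δ * l ∈ uIcc (f (s j)) (f t) by
        rw [uIcc_of_le hle]; exact ⟨by linarith, by linarith⟩)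
      exact ⟨(u, 1), fun _ => ⟨hsub u hu, by simpa using hfu, by simp only; rw [if_pos hle]⟩⟩
    · push Not at hle
      rw [abs_of_neg (by linarith)] at hh
      obtain ⟨u, hu, hfu⟩ := hiv (show f (s j) - 2 * δ * l ∈ uIcc (f (s j)) (f t) by
        rw [uIcc_of_ge hle.le]; exact ⟨by linarith, by linarith⟩)
      exact ⟨(u, -1), fun _ => ⟨hsub u hu, by simp only; rw [hfu]; ring, by
        simp only; rw [if_neg (not_le.2 hle)]⟩⟩
  choose z hz using hpt
  have h := card_le_coverNumber (planeGraph_totallyBounded ε hf) hδ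
    (Finset.range J ×ˢ Finset.range L) (fun q => !₂[(z q).1, f (z q).1]) ?_ ?_
  · rw [Finset.card_product, Finset.card_range, Finset.card_range] at h
    have h1 := Nat.lt_floor_add_one (ε / (2 * δ))
    have h2 : (1 : ℝ) ≤ ε / (4 * δ) := by rw [le_div_iff₀ (by positivity)]; linarith
    have h3 : ε / (2 * δ) = 2 * (ε / (4 * δ)) := by field_simp; norm_num
    have h4 : ε / (4 * δ) ≤ J := by linarith
    have h5 : c * δ ^ (α - 1) / 2 ≤ L := by
      rw [hL]; push_cast; exact (Nat.lt_floor_add_one _).le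
    have h6 : ((J * L : ℕ) : ℝ) ≤ coverNumber (planeGraph (Icc (-ε) ε) f) δ := by exact_mod_cast h
    refine le_trans ?_ h6
    push_cast
    calc ε * c / 8 * δ ^ (-(2 - α)) = ε / (4 * δ) * (c * δ ^ (α - 1) / 2) := by
          rw [show -(2 - α) = α - 1 - 1 by ring, Real.rpow_sub_one hδ.ne' (α - 1)]
          field_simp; norm_num
      _ ≤ J * L := by gcongr
  · rintro ⟨j, l⟩ hq
    rw [Finset.mem_product, Finset.mem_range, Finset.mem_range] at hq
    obtain ⟨h1, -⟩ := hz (j, l) hq.2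
    refine mem_image_of_mem (fun t => !₂[t, f t]) ?_
    have h2 : ((j + 1 : ℕ) : ℝ) ≤ ε / (2 * δ) := (Nat.le_floor_iff (by positivity)).1 hq.1
    rw [le_div_iff₀ (by positivity)] at h2
    push_cast at h2
    rw [abs_le] at h1
    simp only [s] at h1
    have : 0 ≤ δ * j := by positivity
    constructor <;> linarith
  · rintro ⟨j, l⟩ hq ⟨j', l'⟩ hq' hne
    rw [Finset.mem_product, Finset.mem_range, Finset.mem_range] at hq hq'
    obtain ⟨h1, hfz, he⟩ := hz (j, l) hq.2
    obtain ⟨h1', hfz', he'⟩ := hz (j', l') hq'.2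
    by_cases hj : j = j'
    · subst hj
      refine lt_of_lt_of_le ?_ (abs_sub_le_dist_plane _ _ _ _).2
      have hll : l ≠ l' := fun h => hne (by rw [h])
      have h2 : (1 : ℝ) ≤ |(l : ℝ) - l'| := by
        have : (1 : ℤ) ≤ |(l : ℤ) - l'| := Int.one_le_abs (by omega)
        exact_mod_cast this
      rw [hfz, hfz', he, he']
      simp only
      rw [show ∀ a x y b : ℝ, a + b * (2 * δ * x) - (a + b * (2 * δ * y)) = b * (2 * δ * (x - y)) by
        intros; ring, abs_mul]
      rw [show |(if f (s j) ≤ f ((hosc (s j)).choose) then (1 : ℝ) else -1)| = 1 by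
        split_ifs <;> simp, one_mul, abs_mul, abs_of_pos (by positivity : 0 < 2 * δ)]
      nlinarith
    · refine lt_of_lt_of_le ?_ (abs_sub_le_dist_plane _ _ _ _).1
      have h2 : (1 : ℝ) ≤ |(j : ℝ) - j'| := by
        have : (1 : ℤ) ≤ |(j : ℤ) - j'| := Int.one_le_abs (by omega)
        exact_mod_cast this
      have h3 : |s j - s j'| = 4 * δ * |(j : ℝ) - j'| := by
        simp only [s]
        rw [show -ε + δ + 4 * δ * (j : ℝ) - (-ε + δ + 4 * δ * j') = 4 * δ * ((j : ℝ) - j') by ring,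
          abs_mul, abs_of_pos (by positivity)]
      have h4 : |s j - s j'| ≤ |(z (j, l)).1 - s j| + |(z (j, l)).1 - (z (j', l')).1|
          + |(z (j', l')).1 - s j'| := by
        rw [abs_sub_comm _ (s j)]
        calc _ = |(s j - (z (j, l)).1) + ((z (j, l)).1 - (z (j', l')).1)
              + ((z (j', l')).1 - s j')| := by ring_nf
          _ ≤ _ := abs_add_three _ _ _
      simp only at h1 h1'
      nlinarith

theorem hasBoxDim_planeGraph_of_lipschitz {ε : ℝ} (hε : 0 < ε) {f : ℝ → ℝ} {C : ℝ} (hC : 0 ≤ C)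
    (hf : Continuous f) (hL : ∀ s t, |f s - f t| ≤ C * |s - t|) :
    HasBoxDim (planeGraph (Icc (-ε) ε) f) 1 := by
  refine hasBoxDim_of_coverNumber_bounds (planeGraph_nonempty hε f) (planeGraph_totallyBounded ε hf)
    (c := ε / 4) (C := (2 * ε + 1) * (2 * C + 5) * 4) (r := min (ε / 4) 1) (by positivity)
    (by positivity) (by positivity) ?_ ?_
  · intro δ h0 h1
    exact le_coverNumber_planeGraph_of_one hf h0 (h1.trans_le (min_le_left _ _))
  · intro δ h0 h1
    have := coverNumber_planeGraph_le hε (α := 1) le_rfl hC (f := f)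
      (fun s t _ => by simpa using hL s t) one_pos h0 (h1.trans_le (min_le_right _ _))
    norm_num at this ⊢
    exact this

theorem hasBoxDim_planeGraph_of_holder {ε : ℝ} (hε : 0 < ε) {f : ℝ → ℝ} {C c r α : ℝ} (hC : 0 ≤ C)
    (hc : 0 < c) (hr : 0 < r) (hα0 : 0 < α) (hα1 : α ≤ 1) (hf : Continuous f)
    (hH : ∀ s t, |s - t| ≤ 1 → |f s - f t| ≤ C * |s - t| ^ α)
    (hosc : ∀ δ, 0 < δ → δ < r → ∀ s, ∃ t, |t - s| ≤ δ ∧ c * δ ^ α ≤ |f t - f s|) :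
    HasBoxDim (planeGraph (Icc (-ε) ε) f) (2 - α) := by
  refine hasBoxDim_of_coverNumber_bounds (planeGraph_nonempty hε f) (planeGraph_totallyBounded ε hf)
    (c := ε * c / 8) (C := (2 * ε + 1) * (2 * C + 5) * 4) (r := min r (min (ε / 4) 1)) (by positivity)
    (by positivity) (by positivity) ?_ ?_
  · intro δ h0 h1
    rw [lt_min_iff, lt_min_iff] at h1
    exact le_coverNumber_planeGraph hf hc h0 h1.2.1 (hosc δ h0 h1.1)
  · intro δ h0 h1
    rw [lt_min_iff, lt_min_iff] at h1
    exact coverNumber_planeGraph_le hε hα1 hC hH hα0 h0 h1.2.2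

end Graph

end SkewGraph

namespace SkewGraph

/-! ### Integer matrices acting on the torus and on eigenlines. -/

section Torus

variable {k : ℕ}

lemma toTorus_add (x y : Fin k → ℝ) : toTorus (x + y) = toTorus x + toTorus y := by
  funext i; simp [toTorus]

lemma toTorus_zero : toTorus (0 : Fin k → ℝ) = 0 := by
  funext i; simp [toTorus]

lemma isOpenQuotientMap_toTorus : IsOpenQuotientMap (toTorus : (Fin k → ℝ) → UnitAddTorus (Fin k)) :=
  IsOpenQuotientMap.piMap fun _ => QuotientAddGroup.isOpenQuotientMap_mk

lemma continuous_toTorus : Continuous (toTorus : (Fin k → ℝ) → UnitAddTorus (Fin k)) :=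
  isOpenQuotientMap_toTorus.continuous

lemma torusEnd_add (M : Matrix (Fin k) (Fin k) ℤ) (x y : UnitAddTorus (Fin k)) :
    torusEnd M (x + y) = torusEnd M x + torusEnd M y := by
  funext i; simp [torusEnd, Finset.sum_add_distrib]

lemma torusEnd_one (x : UnitAddTorus (Fin k)) : torusEnd 1 x = x := by
  funext i
  simp [torusEnd, Matrix.one_apply, ite_smul]

lemma torusEnd_mul (M N : Matrix (Fin k) (Fin k) ℤ) (x : UnitAddTorus (Fin k)) :
    torusEnd (M * N) x = torusEnd M (torusEnd N x) := by
  funext i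
  simp only [torusEnd, Matrix.mul_apply, Finset.sum_smul, Finset.smul_sum, mul_smul]
  exact Finset.sum_comm

lemma torusEnd_toTorus (M : Matrix (Fin k) (Fin k) ℤ) (x : Fin k → ℝ) :
    torusEnd M (toTorus x) = toTorus (M.map (Int.cast : ℤ → ℝ) *ᵥ x) := by
  funext i
  simp only [torusEnd, toTorus, Matrix.mulVec, dotProduct, Matrix.map_apply]
  have h := map_sum (QuotientAddGroup.mk' (AddSubgroup.zmultiples (1 : ℝ)))
    (fun j => (M i j : ℝ) * x j) Finset.univ
  refine Eq.trans ?_ h.symm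
  refine Finset.sum_congr rfl fun j _ => ?_
  rw [← zsmul_eq_mul, map_zsmul]
  rfl

lemma continuous_torusEnd (M : Matrix (Fin k) (Fin k) ℤ) : Continuous (torusEnd M) := by
  unfold torusEnd
  fun_prop

/-- The automorphism `Aⁿ` of the torus, for `n ∈ ℤ`. -/
def torusPow (A : Matrix.GeneralLinearGroup (Fin k) ℤ) (n : ℤ) (x : UnitAddTorus (Fin k)) :
    UnitAddTorus (Fin k) :=
  torusEnd ((A ^ n : Matrix.GeneralLinearGroup (Fin k) ℤ) : Matrix (Fin k) (Fin k) ℤ) x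

variable (A : Matrix.GeneralLinearGroup (Fin k) ℤ)

lemma torusPow_add (m n : ℤ) (x : UnitAddTorus (Fin k)) :
    torusPow A (m + n) x = torusPow A m (torusPow A n x) := by
  rw [torusPow, zpow_add, Units.val_mul, torusEnd_mul, torusPow, torusPow]

lemma continuous_torusPow (n : ℤ) : Continuous (torusPow A n) := continuous_torusEnd _

/-- `v` is an eigenvector (or zero) of the integer matrix `A` for the real number `b`. -/
def IsEigen (A : Matrix.GeneralLinearGroup (Fin k) ℤ) (b : ℝ) (v : Fin k → ℝ) : Prop :=
  (A : Matrix (Fin k) (Fin k) ℤ).map (Int.cast : ℤ → ℝ) *ᵥ v = b • v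

variable {A} {b : ℝ} {v : Fin k → ℝ}

lemma map_intCast_mul (M N : Matrix (Fin k) (Fin k) ℤ) :
    (M * N).map (Int.cast : ℤ → ℝ) = M.map (Int.cast : ℤ → ℝ) * N.map (Int.cast : ℤ → ℝ) :=
  Matrix.map_mul (f := Int.castRingHom ℝ)

lemma IsEigen.mul {A' : Matrix.GeneralLinearGroup (Fin k) ℤ} {b' : ℝ} (h : IsEigen A b v)
    (h' : IsEigen A' b' v) : IsEigen (A * A') (b * b') v := by
  unfold IsEigen at *
  rw [Units.val_mul, map_intCast_mul, ← Matrix.mulVec_mulVec, h', Matrix.mulVec_smul, h, smul_smul,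
    mul_comm]

lemma isEigen_one : IsEigen (1 : Matrix.GeneralLinearGroup (Fin k) ℤ) 1 v := by
  unfold IsEigen
  rw [Units.val_one, Matrix.map_one _ Int.cast_zero Int.cast_one, Matrix.one_mulVec, one_smul]

lemma IsEigen.inv (h : IsEigen A b v) (hb : b ≠ 0) : IsEigen A⁻¹ b⁻¹ v := by
  have h1 : ((A⁻¹ : Matrix.GeneralLinearGroup (Fin k) ℤ) : Matrix (Fin k) (Fin k) ℤ).map
      (Int.cast : ℤ → ℝ) *ᵥ ((A : Matrix (Fin k) (Fin k) ℤ).map (Int.cast : ℤ → ℝ) *ᵥ v) = v := by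
    rw [Matrix.mulVec_mulVec, ← map_intCast_mul, ← Units.val_mul, inv_mul_cancel]
    simp
  unfold IsEigen at *
  rw [h, Matrix.mulVec_smul] at h1
  rw [← h1, smul_smul, inv_mul_cancel₀ hb, one_smul, h1]

lemma IsEigen.ne_zero (h : IsEigen A b v) (hv : v ≠ 0) : b ≠ 0 := by
  rintro rfl
  apply hv
  have h1 : ((A⁻¹ : Matrix.GeneralLinearGroup (Fin k) ℤ) : Matrix (Fin k) (Fin k) ℤ).map
      (Int.cast : ℤ → ℝ) *ᵥ ((A : Matrix (Fin k) (Fin k) ℤ).map (Int.cast : ℤ → ℝ) *ᵥ v) = v := by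
    rw [Matrix.mulVec_mulVec, ← map_intCast_mul, ← Units.val_mul, inv_mul_cancel]
    simp
  unfold IsEigen at h
  rw [h, zero_smul, Matrix.mulVec_zero] at h1
  exact h1.symm

lemma IsEigen.pow (h : IsEigen A b v) (n : ℕ) : IsEigen (A ^ n) (b ^ n) v := by
  induction n with
  | zero => simpa using isEigen_one
  | succ n ih => rw [pow_succ, pow_succ]; exact ih.mul h

lemma IsEigen.zpow (h : IsEigen A b v) (hb : b ≠ 0) (n : ℤ) : IsEigen (A ^ n) (b ^ n) v := by
  obtain ⟨m, rfl | rfl⟩ := n.eq_nat_or_neg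
  · simpa using h.pow m
  · simpa using (h.inv hb).pow m

lemma IsEigen.torusPow_line (h : IsEigen A b v) (hb : b ≠ 0) (n : ℤ) (t : ℝ) :
    torusPow A n (toTorus (t • v)) = toTorus ((t * b ^ n) • v) := by
  rw [torusPow, torusEnd_toTorus, Matrix.mulVec_smul, h.zpow hb n, smul_smul]

end Torus

/-! ### The self-similar two-sided series. -/

section TwoSided

variable {k : ℕ}

/-- `p` is continuous, bounded by `P`, and `L`-Lipschitz along the lines of direction `v`. -/
structure LineLipschitz (p : UnitAddTorus (Fin k) → ℝ) (v : Fin k → ℝ) (P L : ℝ) : Prop where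
  cont : Continuous p
  bound : ∀ x, |p x| ≤ P
  lip : ∀ x s, |p (x + toTorus (s • v)) - p x| ≤ L * |s|

noncomputable section

/-- The increment `p(A⁻ⁿ(x + tv)) - p(A⁻ⁿ x)`, for an eigenvector `v` of `A` with eigenvalue `b`. -/
def increment (A : Matrix.GeneralLinearGroup (Fin k) ℤ) (b : ℝ) (v : Fin k → ℝ)
    (p : UnitAddTorus (Fin k) → ℝ) (x : UnitAddTorus (Fin k)) (t : ℝ) (n : ℤ) : ℝ :=
  p (torusPow A (-n) x + toTorus ((t * b ^ (-n)) • v)) - p (torusPow A (-n) x)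

/-- The self-similar function `∑_{n ∈ ℤ} λⁿ (p(A⁻ⁿ(x + tv)) - p(A⁻ⁿ x))`. -/
def twoSided (A : Matrix.GeneralLinearGroup (Fin k) ℤ) (lam b : ℝ) (v : Fin k → ℝ)
    (p : UnitAddTorus (Fin k) → ℝ) (x : UnitAddTorus (Fin k)) (t : ℝ) : ℝ :=
  ∑' n : ℤ, lam ^ n * increment A b v p x t n

variable {A : Matrix.GeneralLinearGroup (Fin k) ℤ} {lam b P L : ℝ} {v : Fin k → ℝ}
  {p : UnitAddTorus (Fin k) → ℝ}

lemma LineLipschitz.abs_increment_le (hp : LineLipschitz p v P L) (x : UnitAddTorus (Fin k)) (t : ℝ)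
    (n : ℤ) : |increment A b v p x t n| ≤ 2 * P := by
  have h1 := hp.bound (torusPow A (-n) x + toTorus ((t * b ^ (-n)) • v))
  have h2 := hp.bound (torusPow A (-n) x)
  exact (abs_sub _ _).trans (by linarith)

lemma LineLipschitz.abs_increment_le' (hp : LineLipschitz p v P L) (x : UnitAddTorus (Fin k))
    (t : ℝ) (n : ℤ) : |increment A b v p x t n| ≤ L * |t| * |b| ^ (-n) := by
  refine (hp.lip _ _).trans_eq ?_
  rw [abs_mul, abs_zpow, mul_assoc]

lemma LineLipschitz.nonneg_left (hp : LineLipschitz p v P L) : 0 ≤ P :=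
  (abs_nonneg _).trans (hp.bound 0)

lemma LineLipschitz.nonneg_right (hp : LineLipschitz p v P L) : 0 ≤ L := by
  simpa using (abs_nonneg _).trans (hp.lip 0 1)

lemma zpow_le_max_pow_natAbs (hlam0 : 0 < lam) {n : ℤ} (hn : 0 ≤ n) {c : ℝ} :
    lam ^ n ≤ max lam c ^ n.natAbs := by
  lift n to ℕ using hn
  rw [zpow_natCast, Int.natAbs_natCast]
  exact pow_le_pow_left₀ hlam0.le (le_max_left _ _) _

lemma zpow_mul_zpow_neg_le_max_pow_natAbs (hlam0 : 0 < lam) {n : ℤ} (hn : n < 0) :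
    lam ^ n * |b| ^ (-n) ≤ max lam (|b| / lam) ^ n.natAbs := by
  obtain ⟨m, rfl⟩ := Int.exists_eq_neg_ofNat hn.le
  rw [neg_neg, zpow_neg, zpow_natCast, zpow_natCast, Int.natAbs_neg, Int.natAbs_natCast,
    ← div_eq_inv_mul, ← div_pow]
  exact pow_le_pow_left₀ (by positivity) (le_max_right _ _) _

/-- For n ≥ 0 boundedness of `p` leaves the factor λⁿ; for n < 0 the Lipschitz bound leaves
(|b|/λ)^|n|. Both ratios are below 1 exactly when |b| < λ < 1. -/
lemma LineLipschitz.abs_term_le (hp : LineLipschitz p v P L) (hlam0 : 0 < lam)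
    (x : UnitAddTorus (Fin k)) (t : ℝ) (n : ℤ) :
    |lam ^ n * increment A b v p x t n| ≤
      (2 * P + L * |t|) * max lam (|b| / lam) ^ n.natAbs := by
  have hP := hp.nonneg_left
  have hL := hp.nonneg_right
  have hz : 0 < lam ^ n := zpow_pos hlam0 n
  have hm : 0 ≤ max lam (|b| / lam) ^ n.natAbs := by positivity
  have hLt : 0 ≤ L * |t| := by positivity
  rw [abs_mul, abs_of_pos hz]
  rcases le_or_gt 0 n with hn | hn
  · have h1 := hp.abs_increment_le (A := A) (b := b) x t n
    have h2 := zpow_le_max_pow_natAbs hlam0 hn (c := |b| / lam)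
    calc _ ≤ max lam (|b| / lam) ^ n.natAbs * (2 * P) := by gcongr
      _ ≤ _ := by nlinarith
  · have h1 := hp.abs_increment_le' (A := A) (b := b) x t n
    have h2 := zpow_mul_zpow_neg_le_max_pow_natAbs hlam0 hn (b := b)
    calc _ ≤ lam ^ n * (L * |t| * |b| ^ (-n)) := by gcongr
      _ = L * |t| * (lam ^ n * |b| ^ (-n)) := by ring
      _ ≤ L * |t| * max lam (|b| / lam) ^ n.natAbs := by gcongr
      _ ≤ _ := by nlinarith

lemma summable_pow_natAbs {r : ℝ} (h0 : 0 ≤ r) (h1 : r < 1) :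
    Summable fun n : ℤ => r ^ n.natAbs :=
  Summable.of_nat_of_neg (by simpa using summable_geometric_of_lt_one h0 h1)
    (by simpa using summable_geometric_of_lt_one h0 h1)

lemma max_ratio_nonneg (hlam0 : 0 < lam) : 0 ≤ max lam (|b| / lam) := hlam0.le.trans (le_max_left _ _)

lemma max_ratio_lt_one (hlam0 : 0 < lam) (hlam1 : lam < 1) (hb : |b| < lam) :
    max lam (|b| / lam) < 1 :=
  max_lt hlam1 ((div_lt_one hlam0).2 hb)

lemma LineLipschitz.summable_term (hp : LineLipschitz p v P L) (hlam0 : 0 < lam) (hlam1 : lam < 1)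
    (hb : |b| < lam) (x : UnitAddTorus (Fin k)) (t : ℝ) :
    Summable fun n : ℤ => lam ^ n * increment A b v p x t n :=
  Summable.of_norm_bounded ((summable_pow_natAbs (max_ratio_nonneg hlam0)
    (max_ratio_lt_one hlam0 hlam1 hb)).mul_left _) fun n => hp.abs_term_le hlam0 x t n

lemma LineLipschitz.continuous_twoSided (hp : LineLipschitz p v P L) (hlam0 : 0 < lam)
    (hlam1 : lam < 1) (hb : |b| < lam) (t : ℝ) :
    Continuous fun x => twoSided A lam b v p x t := by
  refine continuous_tsum (fun n => ?_) ((summable_pow_natAbs (max_ratio_nonneg hlam0)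
    (max_ratio_lt_one hlam0 hlam1 hb)).mul_left _) fun n x => hp.abs_term_le hlam0 x t n
  have h1 := hp.cont
  have h2 := continuous_torusPow A (-n)
  unfold increment
  fun_prop

lemma LineLipschitz.exists_abs_twoSided_le (hp : LineLipschitz p v P L) (hlam0 : 0 < lam)
    (hlam1 : lam < 1) (hb : |b| < lam) :
    ∃ C, 0 ≤ C ∧ ∀ x t, |t| ≤ 1 → |twoSided A lam b v p x t| ≤ C := by
  have hs := summable_pow_natAbs (max_ratio_nonneg hlam0) (max_ratio_lt_one hlam0 hlam1 hb)
  have hP := hp.nonneg_left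
  have hL := hp.nonneg_right
  refine ⟨∑' n : ℤ, (2 * P + L) * max lam (|b| / lam) ^ n.natAbs,
    tsum_nonneg fun n => mul_nonneg (by positivity) (pow_nonneg (max_ratio_nonneg hlam0) _),
    fun x t ht => ?_⟩
  rw [twoSided, ← Real.norm_eq_abs]
  refine tsum_of_norm_bounded (hs.mul_left _).hasSum fun n =>
    (hp.abs_term_le hlam0 x t n).trans ?_
  refine mul_le_mul_of_nonneg_right ?_ (pow_nonneg (max_ratio_nonneg hlam0) _)
  nlinarith

/-- The index shift n ↦ n + N is a bijection of ℤ; this exact scaling is the reason for summing over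
all integers. -/
lemma twoSided_scale (hlam0 : 0 < lam) (hb0 : b ≠ 0) (x : UnitAddTorus (Fin k)) (t : ℝ) (N : ℤ) :
    twoSided A lam b v p x t =
      lam ^ N * twoSided A lam b v p (torusPow A (-N) x) (t * b ^ (-N)) := by
  rw [twoSided, twoSided, ← tsum_mul_left, ← (Equiv.addRight N).tsum_eq]
  refine tsum_congr fun n => ?_
  rw [Equiv.coe_addRight, increment, increment, ← torusPow_add, zpow_add₀ hlam0.ne',
    show -n + -N = -(n + N) by ring, mul_assoc t, ← zpow_add₀ hb0, show -N + -n = -(n + N) by ring]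
  ring

lemma twoSided_cocycle (hp : LineLipschitz p v P L) (hA : IsEigen A b v) (hb0 : b ≠ 0)
    (hlam0 : 0 < lam) (hlam1 : lam < 1)
    (hb : |b| < lam) (x : UnitAddTorus (Fin k)) (s t : ℝ) :
    twoSided A lam b v p (x + toTorus (s • v)) t =
      twoSided A lam b v p x (s + t) - twoSided A lam b v p x s := by
  rw [twoSided, twoSided, twoSided, ← Summable.tsum_sub (hp.summable_term hlam0 hlam1 hb x _)
    (hp.summable_term hlam0 hlam1 hb x _)]
  refine tsum_congr fun n => ?_
  have h : torusPow A (-n) (x + toTorus (s • v)) =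
      torusPow A (-n) x + toTorus ((s * b ^ (-n)) • v) := by
    rw [← hA.torusPow_line hb0, torusPow, torusEnd_add]; rfl
  rw [increment, increment, increment, h, add_assoc, ← toTorus_add, ← add_smul, ← add_mul]
  ring

lemma phi_eq (A : Matrix.GeneralLinearGroup (Fin k) ℤ) (x : UnitAddTorus (Fin k)) :
    phi A lam p x = ∑' n : ℕ, lam ^ n * p (torusPow A (-(n : ℤ)) x) := by
  unfold phi torusPow
  simp only [inv_pow, zpow_neg, zpow_natCast]

lemma LineLipschitz.summable_phi (hp : LineLipschitz p v P L) (hlam0 : 0 < lam) (hlam1 : lam < 1)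
    (x : UnitAddTorus (Fin k)) : Summable fun n : ℕ => lam ^ n * p (torusPow A (-(n : ℤ)) x) :=
  Summable.of_norm_bounded ((summable_geometric_of_lt_one hlam0.le hlam1).mul_right P) fun n => by
    rw [Real.norm_eq_abs, abs_mul, abs_of_pos (pow_pos hlam0 n)]
    exact mul_le_mul_of_nonneg_left (hp.bound _) (by positivity)

lemma LineLipschitz.subSlice_sub (hp : LineLipschitz p v P L) (hA : IsEigen A b v) (hb0 : b ≠ 0)
    (hlam0 : 0 < lam) (hlam1 : lam < 1) (x : UnitAddTorus (Fin k)) (s t : ℝ) :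
    subSlice A lam p x v t - subSlice A lam p x v s =
      ∑' n : ℕ, lam ^ n * increment A b v p (toTorus (s • v) + x) (t - s) n := by
  rw [subSlice, subSlice, phi_eq, phi_eq, ← Summable.tsum_sub (hp.summable_phi hlam0 hlam1 _)
    (hp.summable_phi hlam0 hlam1 _)]
  refine tsum_congr fun n => ?_
  have h : ∀ r : ℝ, torusPow A (-(n : ℤ)) (toTorus (r • v) + x) =
      toTorus ((r * b ^ (-(n : ℤ))) • v) + torusPow A (-(n : ℤ)) x := by
    intro r
    rw [← hA.torusPow_line hb0, torusPow, torusEnd_add]; rfl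
  rw [increment, h, h, add_right_comm, ← toTorus_add, ← add_smul, ← add_mul, add_sub_cancel]
  ring

lemma LineLipschitz.subSlice_sub_sub_twoSided (hp : LineLipschitz p v P L)
    (hA : IsEigen A b v) (hb0 : b ≠ 0) (hlam0 : 0 < lam) (hlam1 : lam < 1) (hb : |b| < lam)
    (x : UnitAddTorus (Fin k)) (s t : ℝ) :
    subSlice A lam p x v t - subSlice A lam p x v s
        - twoSided A lam b v p (toTorus (s • v) + x) (t - s) =
      -∑' n : ℕ, lam ^ (-((n : ℤ) + 1)) *
        increment A b v p (toTorus (s • v) + x) (t - s) (-((n : ℤ) + 1)) := by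
  have key : ∀ f : ℤ → ℝ, Summable f → ∑' n : ℕ, f n - ∑' n, f n = -∑' n : ℕ, f (-((n : ℤ) + 1)) := by
    intro f hf
    rw [tsum_of_nat_of_neg_add_one (hf.comp_injective (Nat.cast_injective (R := ℤ)))
      (hf.comp_injective (i := fun n : ℕ => -((n : ℤ) + 1)) fun m n h => by simpa using h)]
    ring
  rw [hp.subSlice_sub hA hb0 hlam0 hlam1, twoSided, ← key _ (hp.summable_term hlam0 hlam1 hb _ _)]
  simp only [zpow_natCast]

/-- The discrepancy consists of the terms of negative index, whose Lipschitz constants L(|b|/λ)ⁿ⁺¹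
are summable. -/
lemma LineLipschitz.abs_subSlice_sub_sub_twoSided_le (hp : LineLipschitz p v P L)
    (hA : IsEigen A b v) (hb0 : b ≠ 0) (hlam0 : 0 < lam) (hlam1 : lam < 1) (hb : |b| < lam) :
    ∃ C, 0 ≤ C ∧ ∀ (x : UnitAddTorus (Fin k)) (s t : ℝ),
      |subSlice A lam p x v t - subSlice A lam p x v s
        - twoSided A lam b v p (toTorus (s • v) + x) (t - s)| ≤ C * |t - s| := by
  have hr : |b| / lam < 1 := (div_lt_one hlam0).2 hb
  have hg : Summable fun n : ℕ => (|b| / lam) ^ (n + 1) :=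
    (summable_nat_add_iff 1).2 (summable_geometric_of_lt_one (by positivity) hr)
  have hL := hp.nonneg_right
  refine ⟨L * ∑' n : ℕ, (|b| / lam) ^ (n + 1),
    mul_nonneg hL (tsum_nonneg fun n => by positivity), fun x s t => ?_⟩
  rw [hp.subSlice_sub_sub_twoSided hA hb0 hlam0 hlam1 hb, abs_neg, mul_right_comm,
    ← tsum_mul_left, ← Real.norm_eq_abs]
  refine tsum_of_norm_bounded (hg.mul_left _).hasSum fun n => ?_
  have h1 := hp.abs_increment_le' (A := A) (b := b) (toTorus (s • v) + x) (t - s) (-((n : ℤ) + 1))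
  rw [neg_neg] at h1
  have h2 : lam ^ (-((n : ℤ) + 1)) = (lam ^ (n + 1))⁻¹ := by
    rw [zpow_neg, ← Nat.cast_add_one, zpow_natCast]
  have h3 : |b| ^ ((n : ℤ) + 1) = |b| ^ (n + 1) := by rw [← Nat.cast_add_one, zpow_natCast]
  rw [h3] at h1
  have h4 : 0 < (lam ^ (n + 1))⁻¹ := by positivity
  rw [Real.norm_eq_abs, abs_mul, h2, abs_of_pos h4, div_pow]
  calc _ ≤ (lam ^ (n + 1))⁻¹ * (L * |t - s| * |b| ^ (n + 1)) :=
        mul_le_mul_of_nonneg_left h1 h4.le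
    _ = _ := by rw [div_eq_mul_inv]; ring

/-- The n-th term has Lipschitz constant L(λ/|b|)ⁿ, and this is summable when λ < |b|. -/
lemma LineLipschitz.abs_subSlice_sub_le (hp : LineLipschitz p v P L)
    (hA : IsEigen A b v) (hlam0 : 0 < lam) (hlam1 : lam < 1) (hb : lam < |b|) :
    ∃ C, 0 ≤ C ∧ ∀ (x : UnitAddTorus (Fin k)) (s t : ℝ),
      |subSlice A lam p x v s - subSlice A lam p x v t| ≤ C * |s - t| := by
  have hb1 : 0 < |b| := hlam0.trans hb
  have hg := summable_geometric_of_lt_one (r := lam / |b|) (by positivity) ((div_lt_one hb1).2 hb)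
  have hL := hp.nonneg_right
  refine ⟨L * ∑' n : ℕ, (lam / |b|) ^ n, mul_nonneg hL (tsum_nonneg fun n => by positivity),
    fun x s t => ?_⟩
  rw [hp.subSlice_sub hA (abs_pos.1 hb1) hlam0 hlam1, mul_right_comm, ← tsum_mul_left, ← Real.norm_eq_abs]
  refine tsum_of_norm_bounded (hg.mul_left _).hasSum fun n => ?_
  have h1 := hp.abs_increment_le' (A := A) (b := b) (toTorus (t • v) + x) (s - t) n
  rw [Real.norm_eq_abs, abs_mul, abs_of_pos (pow_pos hlam0 _), div_pow]
  calc _ ≤ lam ^ n * (L * |s - t| * |b| ^ (-(n : ℤ))) := by gcongr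
    _ = _ := by
      rw [zpow_neg, zpow_natCast]
      field_simp

lemma LineLipschitz.continuous_subSlice (hp : LineLipschitz p v P L) (hlam0 : 0 < lam)
    (hlam1 : lam < 1) (x : UnitAddTorus (Fin k)) : Continuous (subSlice A lam p x v) := by
  unfold subSlice
  simp only [phi_eq]
  refine continuous_tsum (fun n => ?_) ((summable_geometric_of_lt_one hlam0.le hlam1).mul_right P)
    fun n t => ?_
  · have h1 := hp.cont
    have h2 := continuous_torusPow A (-(n : ℤ))
    have h3 := continuous_toTorus (k := k)
    fun_prop
  · rw [Real.norm_eq_abs, abs_mul, abs_of_pos (pow_pos hlam0 n)]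
    exact mul_le_mul_of_nonneg_left (hp.bound _) (by positivity)

/-- Compactness of the torus: for fixed t the two-sided series is continuous in x, so a nonzero
value persists nearby. -/
lemma LineLipschitz.exists_uniform_lower_bound (hp : LineLipschitz p v P L) (hlam0 : 0 < lam)
    (hlam1 : lam < 1) (hb : |b| < lam) (hne : ∀ x, ∃ t, twoSided A lam b v p x t ≠ 0) :
    ∃ T c : ℝ, 0 < T ∧ 0 < c ∧ ∀ x, ∃ t, |t| ≤ T ∧ c ≤ |twoSided A lam b v p x t| := by
  -- One index controls both the range of t and the lower bound, which makes the sets increasing, so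
  -- a single `V N` is the whole torus.
  let V : ℕ → Set (UnitAddTorus (Fin k)) := fun N =>
    ⋃ t ∈ {t : ℝ | |t| ≤ N}, {x | ((N : ℝ) + 1)⁻¹ < |twoSided A lam b v p x t|}
  have hVo : ∀ N, IsOpen (V N) := fun N => isOpen_biUnion fun t _ =>
    isOpen_lt continuous_const (hp.continuous_twoSided hlam0 hlam1 hb t).abs
  have hVc : univ ⊆ ⋃ N, V N := by
    intro x _
    obtain ⟨t, ht⟩ := hne x
    obtain ⟨n, hn⟩ := exists_nat_ge |t|
    obtain ⟨m, hm⟩ := exists_nat_one_div_lt (abs_pos.2 ht)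
    refine mem_iUnion.2 ⟨max n m, mem_iUnion₂.2 ⟨t, ?_, ?_⟩⟩
    · exact hn.trans (by exact_mod_cast le_max_left _ _)
    · refine lt_of_le_of_lt ?_ hm
      rw [one_div]
      have : (m : ℝ) ≤ (max n m : ℕ) := by exact_mod_cast le_max_right n m
      gcongr
  have hVm : Monotone V := by
    intro m n hmn x hx
    obtain ⟨t, ht, hx⟩ := mem_iUnion₂.1 hx
    have hmn' : (m : ℝ) ≤ n := by exact_mod_cast hmn
    have hx' : ((m : ℝ) + 1)⁻¹ < |twoSided A lam b v p x t| := hx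
    have hi : ((n : ℝ) + 1)⁻¹ ≤ ((m : ℝ) + 1)⁻¹ := by gcongr
    exact mem_iUnion₂.2 ⟨t, le_trans ht hmn', hi.trans_lt hx'⟩
  obtain ⟨N, hN⟩ := isCompact_univ.elim_directed_cover V hVo hVc hVm.directed_le
  -- `N + 1` rather than `N`, since `T` must be positive.
  refine ⟨N + 1, ((N : ℝ) + 1)⁻¹, by positivity, by positivity, fun x => ?_⟩
  obtain ⟨t, ht, hx⟩ := mem_iUnion₂.1 (hN (mem_univ x))
  have ht' : |t| ≤ N := ht
  exact ⟨t, by linarith, le_of_lt hx⟩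

end

end TwoSided

end SkewGraph

namespace SkewGraph

/-! ### Dimension of a single slice. -/

section SliceDimension

variable {k : ℕ} {A : Matrix.GeneralLinearGroup (Fin k) ℤ} {lam b P L : ℝ} {v : Fin k → ℝ}
  {p : UnitAddTorus (Fin k) → ℝ}

theorem LineLipschitz.hasBoxDim_one (hp : LineLipschitz p v P L) (hA : IsEigen A b v)
    (hlam0 : 0 < lam) (hlam1 : lam < 1) (hb : lam < |b|) (x : UnitAddTorus (Fin k)) {ε : ℝ}
    (hε : 0 < ε) : HasBoxDim (planeGraph (Icc (-ε) ε) (subSlice A lam p x v)) 1 := by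
  obtain ⟨C, hC, h⟩ := hp.abs_subSlice_sub_le hA hlam0 hlam1 hb
  exact hasBoxDim_planeGraph_of_lipschitz hε hC (hp.continuous_subSlice hlam0 hlam1 x) (h x)

lemma pow_rpow_log_div_log {b lam : ℝ} (hb0 : 0 < b) (hb1 : b < 1) (hlam0 : 0 < lam) (N : ℕ) :
    (b ^ N) ^ (Real.log lam / Real.log b) = lam ^ N := by
  have h : b ^ (Real.log lam / Real.log b) = lam := by
    rw [Real.rpow_def_of_pos hb0, mul_div_cancel₀ _ (Real.log_neg hb0 hb1).ne, Real.exp_log hlam0]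
  rw [← Real.rpow_natCast, ← Real.rpow_mul hb0.le, mul_comm, Real.rpow_mul hb0.le, h,
    Real.rpow_natCast]

/-- With |b|^(N+1) < |t| ≤ |b|^N, scaling by N steps reduces to |t| ≤ 1 at the cost of λ^N. Passing
from λ^N to λ^(N+1) < |t|^α up to equality costs the factor 1/λ. -/
lemma LineLipschitz.exists_abs_twoSided_le_rpow (hp : LineLipschitz p v P L) (hb0 : b ≠ 0)
    (hlam0 : 0 < lam) (hlam1 : lam < 1) (hb : |b| < lam) :
    ∃ C, 0 ≤ C ∧ ∀ x t, t ≠ 0 → |t| ≤ 1 →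
      |twoSided A lam b v p x t| ≤ C * |t| ^ (Real.log lam / Real.log |b|) := by
  obtain ⟨C, hC, h⟩ := hp.exists_abs_twoSided_le (A := A) hlam0 hlam1 hb
  have hb0' : 0 < |b| := abs_pos.2 hb0
  have hb1 : |b| < 1 := hb.trans hlam1
  refine ⟨C / lam, by positivity, fun x t ht0 ht1 => ?_⟩
  obtain ⟨N, hN1, hN2⟩ := exists_nat_pow_near_of_lt_one (abs_pos.2 ht0) ht1 hb0' hb1
  have h1 := h (torusPow A (-(N : ℤ)) x) (t * b ^ (-(N : ℤ))) (by
    rw [abs_mul, zpow_neg, zpow_natCast, abs_inv, abs_pow, ← div_eq_mul_inv]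
    exact div_le_one_of_le₀ hN2 (by positivity))
  have h2 : lam ^ (N + 1) ≤ |t| ^ (Real.log lam / Real.log |b|) := by
    rw [← pow_rpow_log_div_log hb0' hb1 hlam0]
    exact Real.rpow_le_rpow (by positivity) hN1.le
      (div_nonneg_of_nonpos (Real.log_neg hlam0 hlam1).le (Real.log_neg hb0' hb1).le)
  rw [twoSided_scale hlam0 hb0 x t N, abs_mul, zpow_natCast, abs_of_pos (pow_pos hlam0 N)]
  calc lam ^ N * |twoSided A lam b v p (torusPow A (-(N : ℤ)) x) (t * b ^ (-(N : ℤ)))|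
      ≤ lam ^ N * C := by gcongr
    _ = C / lam * lam ^ (N + 1) := by rw [pow_succ]; field_simp
    _ ≤ _ := by gcongr

/-- The witness for the point A^-(N+1) x, multiplied by b^(N+1), becomes one for x at scale δ, where
|b|^(N+1) < δ/T ≤ |b|^N. -/
lemma exists_rpow_le_abs_twoSided (hb0 : b ≠ 0)
    (hlam0 : 0 < lam) (hlam1 : lam < 1) (hb : |b| < lam) {T c : ℝ} (hT : 0 < T) (hc : 0 < c)
    (h : ∀ x, ∃ t, |t| ≤ T ∧ c ≤ |twoSided A lam b v p x t|) :
    ∃ c', 0 < c' ∧ ∀ x δ, 0 < δ → δ ≤ T → ∃ t, |t| ≤ δ ∧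
      c' * δ ^ (Real.log lam / Real.log |b|) ≤ |twoSided A lam b v p x t| := by
  have hb0' : 0 < |b| := abs_pos.2 hb0
  have hb1 : |b| < 1 := hb.trans hlam1
  set α := Real.log lam / Real.log |b| with hα
  have hα0 : 0 ≤ α :=
    div_nonneg_of_nonpos (Real.log_neg hlam0 hlam1).le (Real.log_neg hb0' hb1).le
  refine ⟨c * lam / T ^ α, by positivity, fun x δ hδ hδT => ?_⟩
  obtain ⟨N, hN1, hN2⟩ := exists_nat_pow_near_of_lt_one (div_pos hδ hT) (div_le_one_of_le₀ hδT hT.le)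
    hb0' hb1
  obtain ⟨t, ht, hct⟩ := h (torusPow A (-((N + 1 : ℕ) : ℤ)) x)
  have hbN : b ^ (N + 1) ≠ 0 := pow_ne_zero _ hb0
  refine ⟨t * b ^ (N + 1), ?_, ?_⟩
  · rw [abs_mul, abs_pow]
    rw [lt_div_iff₀ hT] at hN1
    nlinarith [pow_pos hb0' (N + 1)]
  · rw [twoSided_scale hlam0 hb0 x _ (N + 1 : ℕ), zpow_neg, zpow_natCast, zpow_natCast,
      mul_assoc, mul_inv_cancel₀ hbN, mul_one, abs_mul, abs_of_pos (pow_pos hlam0 _)]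
    have h2 : (δ / T) ^ α ≤ lam ^ N := by
      rw [← pow_rpow_log_div_log hb0' hb1 hlam0]
      exact Real.rpow_le_rpow (by positivity) hN2 hα0
    rw [Real.div_rpow hδ.le hT.le] at h2
    calc c * lam / T ^ α * δ ^ α = δ ^ α / T ^ α * lam * c := by ring
      _ ≤ lam ^ N * lam * |twoSided A lam b v p (torusPow A (-((N + 1 : ℕ) : ℤ)) x) t| := by gcongr
      _ = _ := by rw [pow_succ]

theorem LineLipschitz.hasBoxDim_of_twoSided_ne_zero (hp : LineLipschitz p v P L)
    (hA : IsEigen A b v) (hb0 : b ≠ 0) (hlam0 : 0 < lam) (hlam1 : lam < 1) (hb : |b| < lam)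
    (hne : ∀ x, ∃ t, twoSided A lam b v p x t ≠ 0) (x : UnitAddTorus (Fin k)) {ε : ℝ}
    (hε : 0 < ε) :
    HasBoxDim (planeGraph (Icc (-ε) ε) (subSlice A lam p x v))
      (2 - Real.log lam / Real.log |b|) := by
  have hb0' : 0 < |b| := abs_pos.2 hb0
  have hb1 : |b| < 1 := hb.trans hlam1
  obtain ⟨T, c₀, hT, hc₀, h0⟩ := hp.exists_uniform_lower_bound hlam0 hlam1 hb hne
  obtain ⟨c, hc, hlow⟩ := exists_rpow_le_abs_twoSided hb0 hlam0 hlam1 hb hT hc₀ h0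
  obtain ⟨C, hC, hup⟩ := hp.exists_abs_twoSided_le_rpow (A := A) hb0 hlam0 hlam1 hb
  obtain ⟨C₁, hC₁, hcomp⟩ := hp.abs_subSlice_sub_sub_twoSided_le hA hb0 hlam0 hlam1 hb
  have hlb := Real.log_neg hb0' hb1
  have hα0 : 0 < Real.log lam / Real.log |b| := div_pos_of_neg_of_neg (Real.log_neg hlam0 hlam1) hlb
  have hα1 : Real.log lam / Real.log |b| < 1 :=
    (div_lt_one_of_neg hlb).2 (Real.log_lt_log hb0' hb)
  set α := Real.log lam / Real.log |b| with hα
  -- As α < 1, the Lipschitz error C₁δ is eventually at most half of the oscillation cδ^α.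
  obtain ⟨r, hr0, hr⟩ : ∃ r > 0, ∀ δ, 0 < δ → δ < r → C₁ * δ ^ (1 - α) ≤ c / 2 := by
    have h1 : Tendsto (fun δ : ℝ => C₁ * δ ^ (1 - α)) (𝓝 0) (𝓝 (C₁ * 0 ^ (1 - α))) :=
      ((Real.continuous_rpow_const (by linarith)).tendsto 0).const_mul C₁
    rw [Real.zero_rpow (by linarith), mul_zero] at h1
    obtain ⟨r, hr, h2⟩ := Metric.eventually_nhds_iff.1 (h1.eventually_lt_const (half_pos hc))
    exact ⟨r, hr, fun δ h3 h4 => (h2 (by rwa [Real.dist_eq, sub_zero, abs_of_pos h3])).le⟩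
  refine hasBoxDim_planeGraph_of_holder hε (C := C + C₁) (c := c / 2) (r := min r T) (by positivity)
    (by positivity) (by positivity) hα0 hα1.le (hp.continuous_subSlice hlam0 hlam1 x) ?_ ?_
  · intro t s hst
    rcases eq_or_ne t s with rfl | hne'
    · rw [sub_self, abs_zero]
      positivity
    · have hpos : 0 < |t - s| := abs_pos.2 (sub_ne_zero.2 hne')
      have h1 := hup (toTorus (s • v) + x) (t - s) (sub_ne_zero.2 hne') hst
      have h2 := hcomp x s t
      have h3 : |t - s| ≤ |t - s| ^ α := by
        simpa using Real.rpow_le_rpow_of_exponent_ge hpos hst hα1.le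
      have h4 := abs_add_le (subSlice A lam p x v t - subSlice A lam p x v s
        - twoSided A lam b v p (toTorus (s • v) + x) (t - s))
        (twoSided A lam b v p (toTorus (s • v) + x) (t - s))
      rw [sub_add_cancel] at h4
      nlinarith
  · intro δ hδ hδr s
    rw [lt_min_iff] at hδr
    obtain ⟨t, ht, hct⟩ := hlow (toTorus (s • v) + x) δ hδ hδr.2.le
    refine ⟨s + t, by simpa using ht, ?_⟩
    have h2 := hcomp x s (s + t)
    rw [add_sub_cancel_left] at h2
    have h3 := hr δ hδ hδr.1
    have h4 : C₁ * δ ≤ c / 2 * δ ^ α := by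
      calc C₁ * δ = C₁ * δ ^ (1 - α) * δ ^ α := by
            rw [mul_assoc, ← Real.rpow_add hδ]; simp
        _ ≤ _ := by gcongr
    have h5 : C₁ * |t| ≤ C₁ * δ := by gcongr
    have h6 := abs_sub_abs_le_abs_sub (twoSided A lam b v p (toTorus (s • v) + x) t)
      (subSlice A lam p x v (s + t) - subSlice A lam p x v s)
    rw [abs_sub_comm (twoSided A lam b v p (toTorus (s • v) + x) t)] at h6
    linarith

end SliceDimension

end SkewGraph

namespace SkewGraph

open UnitAddTorus

/-! ### Mean values of almost periodic series. -/

section Exponential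

/-- The unit complex number `exp(2πis)`. -/
noncomputable def unitExp (s : ℝ) : ℂ := Complex.exp (Complex.I * ((2 * Real.pi * s : ℝ) : ℂ))

lemma unitExp_zero : unitExp 0 = 1 := by simp [unitExp]

lemma unitExp_add (s t : ℝ) : unitExp (s + t) = unitExp s * unitExp t := by
  rw [unitExp, unitExp, unitExp, ← Complex.exp_add]
  push_cast; ring_nf

lemma norm_unitExp (s : ℝ) : ‖unitExp s‖ = 1 := by
  rw [unitExp, mul_comm, Complex.norm_exp_ofReal_mul_I]

lemma norm_unitExp_sub_one_le (s : ℝ) : ‖unitExp s - 1‖ ≤ 2 * Real.pi * |s| := by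
  refine Real.norm_exp_I_mul_ofReal_sub_one_le.trans_eq ?_
  rw [Real.norm_eq_abs, abs_mul, abs_of_pos Real.two_pi_pos]

lemma norm_unitExp_sub_one_le_two (s : ℝ) : ‖unitExp s - 1‖ ≤ 2 := by
  refine (norm_sub_le _ _).trans ?_
  rw [norm_unitExp, norm_one]; norm_num

lemma unitExp_half : unitExp (1 / 2) = -1 := by
  rw [unitExp, ← Complex.exp_pi_mul_I]
  push_cast; ring_nf

lemma unitExp_intCast (n : ℤ) : unitExp n = 1 := by
  rw [unitExp, Complex.exp_eq_one_iff]
  exact ⟨n, by push_cast; ring⟩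

lemma continuous_unitExp : Continuous unitExp := by
  unfold unitExp; fun_prop

lemma tendsto_mean_unitExp {w : ℝ} (hw : w ≠ 0) :
    Tendsto (fun T : ℝ => (T⁻¹ : ℂ) * ∫ t in (0 : ℝ)..T, unitExp (w * t)) atTop (𝓝 0) := by
  have hc : Complex.I * ((2 * Real.pi * w : ℝ) : ℂ) ≠ 0 :=
    mul_ne_zero Complex.I_ne_zero (by exact_mod_cast mul_ne_zero Real.two_pi_pos.ne' hw)
  have h1 : ∀ T : ℝ, ∫ t in (0 : ℝ)..T, unitExp (w * t) =
      (unitExp (w * T) - 1) / (Complex.I * ((2 * Real.pi * w : ℝ) : ℂ)) := by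
    intro T
    have h2 : ∀ t : ℝ, unitExp (w * t) = Complex.exp (Complex.I * ((2 * Real.pi * w : ℝ) : ℂ) * t) := by
      intro t; rw [unitExp]; push_cast; ring_nf
    simp only [h2, integral_exp_mul_complex hc]
    simp
  have h3 : Tendsto (fun T : ℝ => T⁻¹ * (2 / ‖Complex.I * ((2 * Real.pi * w : ℝ) : ℂ)‖))
      atTop (𝓝 0) := by
    simpa using tendsto_inv_atTop_zero.mul_const (2 / ‖Complex.I * ((2 * Real.pi * w : ℝ) : ℂ)‖)
  refine squeeze_zero_norm' ?_ h3
  filter_upwards [eventually_gt_atTop 0] with T hT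
  rw [h1, norm_mul, norm_div, norm_inv, Complex.norm_real, Real.norm_eq_abs, abs_of_pos hT]
  gcongr
  exact norm_unitExp_sub_one_le_two _

/-- Averaging over `[0, T]` and letting T → ∞ kills every nonzero frequency and retains the zero
ones; dominated convergence handles both the integral and the limit. -/
lemma tsum_ite_eq_zero_of_forall_tsum_unitExp_eq_zero {ι : Type*} [Countable ι] {c : ι → ℂ}
    (hc : Summable fun i => ‖c i‖) {w : ι → ℝ} (h : ∀ t, ∑' i, c i * unitExp (w i * t) = 0) :
    ∑' i, (if w i = 0 then c i else 0) = 0 := by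
  have h1 : ∀ T : ℝ, HasSum (fun i => ∫ t in (0 : ℝ)..T, c i * unitExp (w i * t)) 0 := by
    intro T
    have h2 := intervalIntegral.hasSum_integral_of_dominated_convergence (a := 0) (b := T)
      (μ := MeasureTheory.volume) (F := fun i t => c i * unitExp (w i * t)) (f := fun _ => 0)
      (bound := fun i _ => ‖c i‖) ?_ ?_ ?_ ?_ ?_
    · simpa using h2
    · intro i
      exact (continuous_const.mul (continuous_unitExp.comp (by fun_prop))).aestronglyMeasurable
    · intro i
      refine MeasureTheory.ae_of_all _ fun t _ => ?_
      rw [norm_mul, norm_unitExp, mul_one]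
    · exact MeasureTheory.ae_of_all _ fun t _ => hc
    · simp
    · refine MeasureTheory.ae_of_all _ fun t _ => ?_
      have hs : Summable fun i => c i * unitExp (w i * t) :=
        Summable.of_norm (by simpa [norm_unitExp] using hc)
      simpa [h t] using hs.hasSum
  have h3 : Tendsto (fun T : ℝ => ∑' i, (T⁻¹ : ℂ) * ∫ t in (0 : ℝ)..T, c i * unitExp (w i * t))
      atTop (𝓝 (∑' i, (if w i = 0 then c i else 0))) := by
    refine tendsto_tsum_of_dominated_convergence (bound := fun i => ‖c i‖) hc ?_ ?_
    · intro i
      simp only [intervalIntegral.integral_const_mul]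
      split_ifs with hw
      · refine tendsto_const_nhds.congr' ?_
        filter_upwards [eventually_gt_atTop 0] with T hT
        have : (T : ℂ) ≠ 0 := by exact_mod_cast hT.ne'
        simp [hw, unitExp_zero]
        field_simp
      · simpa [mul_left_comm] using (tendsto_mean_unitExp hw).const_mul (c i)
    · filter_upwards [eventually_gt_atTop 0] with T hT i
      have h4 := intervalIntegral.norm_integral_le_of_norm_le_const (a := 0) (b := T) (C := ‖c i‖)
        (f := fun t => c i * unitExp (w i * t)) (fun t _ => by rw [norm_mul, norm_unitExp, mul_one])
      rw [sub_zero, abs_of_pos hT] at h4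
      rw [norm_mul, norm_inv, Complex.norm_real, Real.norm_eq_abs, abs_of_pos hT]
      calc _ ≤ T⁻¹ * (‖c i‖ * T) := by gcongr
        _ = _ := by field_simp
  have h5 : ∀ T : ℝ, ∑' i, (T⁻¹ : ℂ) * ∫ t in (0 : ℝ)..T, c i * unitExp (w i * t) = 0 := by
    intro T
    rw [tsum_mul_left, (h1 T).tsum_eq, mul_zero]
  simp only [h5] at h3
  exact (tendsto_nhds_unique tendsto_const_nhds h3).symm

end Exponential

/-! ### Characters of the torus. -/

section Characters

variable {k : ℕ}

/-- The pairing of an integer vector with a real vector. -/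
def pairing (ξ : Fin k → ℤ) (w : Fin k → ℝ) : ℝ := ∑ i, (ξ i : ℝ) * w i

lemma pairing_smul (ξ : Fin k → ℤ) (t : ℝ) (w : Fin k → ℝ) :
    pairing ξ (t • w) = t * pairing ξ w := by
  simp only [pairing, Pi.smul_apply, smul_eq_mul, Finset.mul_sum]
  exact Finset.sum_congr rfl fun i _ => by ring

lemma abs_pairing_le (ξ : Fin k → ℤ) (w : Fin k → ℝ) : |pairing ξ w| ≤ (∑ i, |w i|) * ‖ξ‖ := by
  rw [pairing, Finset.sum_mul]
  refine (Finset.abs_sum_le_sum_abs _ _).trans (Finset.sum_le_sum fun i _ => ?_)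
  rw [abs_mul, mul_comm]
  gcongr
  have h := norm_le_pi_norm ξ i
  rwa [Int.norm_eq_abs] at h

lemma mFourier_apply_add (ξ : Fin k → ℤ) (x y : UnitAddTorus (Fin k)) :
    mFourier ξ (x + y) = mFourier ξ x * mFourier ξ y := by
  simp [mFourier, fourier_apply, smul_add, AddCircle.toCircle_add, Finset.prod_mul_distrib]

lemma mFourier_toTorus (ξ : Fin k → ℤ) (x : Fin k → ℝ) :
    mFourier ξ (toTorus x) = unitExp (pairing ξ x) := by
  simp only [mFourier, ContinuousMap.coe_mk, toTorus, fourier_coe_apply]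
  rw [← Complex.exp_sum, unitExp, pairing]
  congr 1
  push_cast
  rw [Finset.mul_sum, Finset.mul_sum]
  exact Finset.sum_congr rfl fun i _ => by ring

lemma norm_mFourier_apply (ξ : Fin k → ℤ) (x : UnitAddTorus (Fin k)) : ‖mFourier ξ x‖ = 1 := by
  obtain ⟨y, rfl⟩ := isOpenQuotientMap_toTorus.surjective x
  rw [mFourier_toTorus, norm_unitExp]

end Characters

/-! ### A dominant Fourier coefficient prevents vanishing. -/

section NonVanishing

variable {k : ℕ}

/-- `p` is the sum of the Fourier series with coefficients `a`, with `∑ (1 + ‖ξ‖) ‖a ξ‖ < ∞`. -/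
structure HasFourier (p : UnitAddTorus (Fin k) → ℝ) (a : (Fin k → ℤ) → ℂ) : Prop where
  cont : Continuous p
  summable : Summable fun ξ => (1 + ‖ξ‖) * ‖a ξ‖
  hasSum : ∀ x, HasSum (fun ξ => a ξ * mFourier ξ x) (p x : ℂ)

/-- The weight given to `ξ` in the comparison of the Fourier coefficient at `ξ₀` with the other
coefficients in its orbit. -/
noncomputable def orbitWeight (b : ℝ) (v : Fin k → ℝ) (ξ₀ ξ : Fin k → ℤ) : ℝ :=
  open Classical in
  if ξ ≠ ξ₀ ∧ ∃ n : ℤ, pairing ξ v = b ^ n * pairing ξ₀ v then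
    1 + |pairing ξ v| / |pairing ξ₀ v| else 0

variable {p : UnitAddTorus (Fin k) → ℝ} {a : (Fin k → ℤ) → ℂ} {v : Fin k → ℝ} {b : ℝ}
  {A : Matrix.GeneralLinearGroup (Fin k) ℤ} {lam : ℝ}

lemma orbitWeight_nonneg (ξ₀ ξ : Fin k → ℤ) : 0 ≤ orbitWeight b v ξ₀ ξ := by
  unfold orbitWeight
  split_ifs <;> positivity

lemma orbitWeight_le (ξ₀ ξ : Fin k → ℤ) :
    orbitWeight b v ξ₀ ξ ≤ (1 + (∑ i, |v i|) / |pairing ξ₀ v|) * (1 + ‖ξ‖) := by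
  have h0 : 0 ≤ ∑ i, |v i| := Finset.sum_nonneg fun i _ => abs_nonneg _
  unfold orbitWeight
  split_ifs
  · have h1 := div_le_div_of_nonneg_right (abs_pairing_le ξ v) (abs_nonneg (pairing ξ₀ v))
    rw [mul_div_right_comm] at h1
    have h2 : 0 ≤ (∑ i, |v i|) / |pairing ξ₀ v| := by positivity
    nlinarith [norm_nonneg ξ]
  · positivity

lemma HasFourier.summable_norm (h : HasFourier p a) : Summable fun ξ => ‖a ξ‖ :=
  Summable.of_nonneg_of_le (fun _ => norm_nonneg _)
    (fun ξ => by nlinarith [norm_nonneg ξ, norm_nonneg (a ξ), mul_nonneg (norm_nonneg ξ) (norm_nonneg (a ξ))]) h.summable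

lemma HasFourier.summable_orbitWeight (h : HasFourier p a) (ξ₀ : Fin k → ℤ) :
    Summable fun ξ => orbitWeight b v ξ₀ ξ * ‖a ξ‖ := by
  refine Summable.of_nonneg_of_le (fun ξ => mul_nonneg (orbitWeight_nonneg _ _) (norm_nonneg _))
    (fun ξ => ?_) (h.summable.mul_left (1 + (∑ i, |v i|) / |pairing ξ₀ v|))
  rw [← mul_assoc]
  exact mul_le_mul_of_nonneg_right (orbitWeight_le _ _) (norm_nonneg _)

lemma HasFourier.hasSum_sub (h : HasFourier p a) (x : UnitAddTorus (Fin k)) (t s : ℝ) :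
    HasSum (fun ξ => a ξ * mFourier ξ x * (unitExp (s * pairing ξ v) - 1) *
      unitExp (t * pairing ξ v))
      ((p (x + toTorus (t • v) + toTorus (s • v)) - p (x + toTorus (t • v)) : ℝ) : ℂ) := by
  rw [Complex.ofReal_sub]
  refine HasSum.congr_fun ((h.hasSum (x + toTorus (t • v) + toTorus (s • v))).sub
    (h.hasSum (x + toTorus (t • v)))) fun ξ => ?_
  simp only [mFourier_apply_add, mFourier_toTorus, pairing_smul]
  ring

lemma HasFourier.lineLipschitz (h : HasFourier p a) (v : Fin k → ℝ) :
    ∃ P L, LineLipschitz p v P L := by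
  refine ⟨∑' ξ, ‖a ξ‖, ∑' ξ, 2 * Real.pi * (∑ i, |v i|) * ((1 + ‖ξ‖) * ‖a ξ‖), h.cont, ?_, ?_⟩
  · intro x
    rw [← Real.norm_eq_abs, ← Complex.norm_real, ← (h.hasSum x).tsum_eq]
    refine tsum_of_norm_bounded h.summable_norm.hasSum fun ξ => ?_
    rw [norm_mul, norm_mFourier_apply, mul_one]
  · intro x s
    have h1 := h.hasSum_sub (v := v) x 0 s
    simp only [zero_smul, toTorus_zero, add_zero, zero_mul, unitExp_zero, mul_one] at h1
    rw [← Real.norm_eq_abs, ← Complex.norm_real, ← h1.tsum_eq, ← tsum_mul_right]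
    refine tsum_of_norm_bounded ((h.summable.mul_left _).mul_right _).hasSum fun ξ => ?_
    rw [norm_mul, norm_mul, norm_mFourier_apply, mul_one]
    have h2 := (norm_unitExp_sub_one_le (s * pairing ξ v)).trans_eq (by rw [abs_mul])
    have h3 := abs_pairing_le ξ v
    have h0 : 0 ≤ ∑ i, |v i| := Finset.sum_nonneg fun i _ => abs_nonneg _
    have hpi := Real.pi_pos
    calc _ ≤ ‖a ξ‖ * (2 * Real.pi * (|s| * |pairing ξ v|)) := by gcongr
      _ ≤ ‖a ξ‖ * (2 * Real.pi * (|s| * ((∑ i, |v i|) * (1 + ‖ξ‖)))) := by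
        gcongr
        refine h3.trans ?_
        gcongr
        linarith
      _ = _ := by ring

/-- The coefficient of the almost periodic function `t ↦ ∑ₙ λⁿ (p(A⁻ⁿ(x + (t + h)v)) -
p(A⁻ⁿ(x + tv)))` indexed by `(n, ξ)`. -/
noncomputable def leafCoeff (A : Matrix.GeneralLinearGroup (Fin k) ℤ) (lam b : ℝ) (v : Fin k → ℝ)
    (a : (Fin k → ℤ) → ℂ) (x : UnitAddTorus (Fin k)) (h : ℝ) (q : ℤ × (Fin k → ℤ)) : ℂ :=
  (lam : ℂ) ^ q.1 * (a q.2 * mFourier q.2 (torusPow A (-q.1) x) *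
    (unitExp (h * (b ^ (-q.1) * pairing q.2 v)) - 1))

lemma norm_leafCoeff (hlam0 : 0 < lam) (x : UnitAddTorus (Fin k)) (h : ℝ) (q : ℤ × (Fin k → ℤ)) :
    ‖leafCoeff A lam b v a x h q‖ = lam ^ q.1 *
      (‖a q.2‖ * ‖unitExp (h * (b ^ (-q.1) * pairing q.2 v)) - 1‖) := by
  rw [leafCoeff, norm_mul, norm_mul, norm_mul, norm_mFourier_apply, mul_one, norm_zpow,
    Complex.norm_real, Real.norm_eq_abs, abs_of_pos hlam0]

/-- The same splitting by the sign of n as in `LineLipschitz.abs_term_le`. Negative n use |e(s) − 1|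
≤ 2π|s|, which brings in a factor ‖ξ‖; hence the weight in `HasFourier`. -/
lemma HasFourier.summable_leafCoeff (hF : HasFourier p a) (hlam0 : 0 < lam) (hlam1 : lam < 1)
    (hb : |b| < lam) (x : UnitAddTorus (Fin k)) (h : ℝ) :
    Summable fun q => ‖leafCoeff A lam b v a x h q‖ := by
  have hs := (summable_pow_natAbs (max_ratio_nonneg hlam0) (max_ratio_lt_one hlam0 hlam1 hb))
  have h0 : 0 ≤ ∑ i, |v i| := Finset.sum_nonneg fun i _ => abs_nonneg _
  have hpi := Real.pi_pos
  refine Summable.of_nonneg_of_le (fun _ => norm_nonneg _) (fun q => ?_)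
    (hs.mul_of_nonneg (hF.summable.mul_left (2 + 2 * Real.pi * |h| * ∑ i, |v i|))
      (fun n => pow_nonneg (max_ratio_nonneg hlam0) _) (fun ξ => by positivity))
  obtain ⟨n, ξ⟩ := q
  rw [norm_leafCoeff hlam0]
  have hz : 0 < lam ^ n := zpow_pos hlam0 n
  have hm : 0 ≤ max lam (|b| / lam) ^ n.natAbs := pow_nonneg (max_ratio_nonneg hlam0) _
  have hB : 0 ≤ 2 * Real.pi * |h| * ∑ i, |v i| := by positivity
  have hB' := mul_nonneg hB (norm_nonneg ξ)
  simp only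
  rcases le_or_gt 0 n with hn | hn
  · have h2 := zpow_le_max_pow_natAbs hlam0 hn (c := |b| / lam)
    have h3 := norm_unitExp_sub_one_le_two (h * (b ^ (-n) * pairing ξ v))
    calc _ ≤ max lam (|b| / lam) ^ n.natAbs * (‖a ξ‖ * 2) := by gcongr
      _ ≤ max lam (|b| / lam) ^ n.natAbs *
          (‖a ξ‖ * ((2 + 2 * Real.pi * |h| * ∑ i, |v i|) * (1 + ‖ξ‖))) := by
        gcongr
        nlinarith [norm_nonneg ξ]
      _ = _ := by ring
  · have h2 := zpow_mul_zpow_neg_le_max_pow_natAbs hlam0 hn (b := b)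
    have h3 := norm_unitExp_sub_one_le (h * (b ^ (-n) * pairing ξ v))
    rw [abs_mul, abs_mul, abs_zpow] at h3
    have h4 := abs_pairing_le ξ v
    have hbn : 0 ≤ |b| ^ (-n) := by positivity
    calc _ ≤ lam ^ n * (‖a ξ‖ * (2 * Real.pi * (|h| * (|b| ^ (-n) *
            ((∑ i, |v i|) * ‖ξ‖))))) := by
          gcongr
          exact h3.trans (by gcongr)
      _ = (lam ^ n * |b| ^ (-n)) * (‖a ξ‖ * (2 * Real.pi * |h| * (∑ i, |v i|) * ‖ξ‖)) := by ring
      _ ≤ max lam (|b| / lam) ^ n.natAbs *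
          (‖a ξ‖ * ((2 + 2 * Real.pi * |h| * ∑ i, |v i|) * (1 + ‖ξ‖))) := by
        have h5 : 2 * Real.pi * |h| * (∑ i, |v i|) * ‖ξ‖ ≤
            (2 + 2 * Real.pi * |h| * ∑ i, |v i|) * (1 + ‖ξ‖) := by nlinarith [norm_nonneg ξ]
        exact mul_le_mul h2 (mul_le_mul_of_nonneg_left h5 (norm_nonneg _)) (by positivity) hm
      _ = _ := by ring

lemma HasFourier.tsum_leafCoeff (hF : HasFourier p a) (hA : IsEigen A b v) (hb0 : b ≠ 0)
    (hlam0 : 0 < lam) (hlam1 : lam < 1)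
    (hb : |b| < lam) (x : UnitAddTorus (Fin k)) (h t : ℝ) :
    ∑' q, leafCoeff A lam b v a x h q * unitExp (b ^ (-q.1) * pairing q.2 v * t) =
      ((twoSided A lam b v p x (t + h) - twoSided A lam b v p x t : ℝ) : ℂ) := by
  obtain ⟨P, L, hp⟩ := hF.lineLipschitz v
  have hs : Summable fun q => leafCoeff A lam b v a x h q *
      unitExp (b ^ (-q.1) * pairing q.2 v * t) :=
    Summable.of_norm (by
      simpa [norm_unitExp] using hF.summable_leafCoeff (A := A) (v := v) hlam0 hlam1 hb x h)
  rw [hs.tsum_prod, ← twoSided_cocycle hp hA hb0 hlam0 hlam1 hb, twoSided, Complex.ofReal_tsum]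
  refine tsum_congr fun n => ?_
  have h1 : torusPow A (-n) (x + toTorus (t • v)) =
      torusPow A (-n) x + toTorus ((t * b ^ (-n)) • v) := by
    rw [← hA.torusPow_line hb0, torusPow, torusEnd_add]; rfl
  rw [increment, h1, Complex.ofReal_mul, Complex.ofReal_zpow,
    ← (hF.hasSum_sub (torusPow A (-n) x) (t * b ^ (-n)) (h * b ^ (-n))).tsum_eq, ← tsum_mul_left]
  refine tsum_congr fun ξ => ?_
  rw [leafCoeff, mul_assoc]
  rw [show h * (b ^ (-n) * pairing ξ v) = h * b ^ (-n) * pairing ξ v by ring,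
    show b ^ (-n) * pairing ξ v * t = t * b ^ (-n) * pairing ξ v by ring]

lemma zpow_injective_of_abs_lt_one (hb0 : b ≠ 0) (hb1 : |b| < 1) {m n : ℤ} (h : b ^ m = b ^ n) :
    m = n := by
  have h1 := congrArg abs h
  rw [abs_zpow, abs_zpow] at h1
  exact zpow_right_injective₀ (abs_pos.2 hb0) hb1.ne h1

/-- If the series vanished for all t, its coefficient at frequency ⟨ξ₀,v⟩ would be zero, which
forces |a(ξ₀)| ≤ ∑ λⁿ|a(ξ)| over the rest of the orbit, against `hdom`. -/
theorem HasFourier.exists_twoSided_ne_zero (hF : HasFourier p a) (hA : IsEigen A b v) (hb0 : b ≠ 0)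
    (hlam0 : 0 < lam) (hlam1 : lam < 1) (hb : |b| < lam) {ξ₀ : Fin k → ℤ}
    (hξ₀ : pairing ξ₀ v ≠ 0) (hdom : ∑' ξ, orbitWeight b v ξ₀ ξ * ‖a ξ‖ < ‖a ξ₀‖)
    (x : UnitAddTorus (Fin k)) : ∃ t, twoSided A lam b v p x t ≠ 0 := by
  classical
  by_contra! hzero
  have hb1 : |b| < 1 := hb.trans hlam1
  set w₀ := pairing ξ₀ v with hw₀
  -- With this increment the factor e(h·w₀) − 1 equals −2 for every pair (n, ξ) of frequency w₀.
  set h : ℝ := 1 / 2 / w₀ with hh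
  set c := leafCoeff A lam b v a x h with hc
  have hcs : Summable fun q => ‖c q‖ := hF.summable_leafCoeff hlam0 hlam1 hb x h
  -- Modulation by e(−w₀t) moves the frequency w₀ to 0, where the mean value detects it.
  have h1 : ∀ t, ∑' q : ℤ × (Fin k → ℤ), c q * unitExp ((b ^ (-q.1) * pairing q.2 v - w₀) * t)
      = 0 := by
    intro t
    have h2 := hF.tsum_leafCoeff (lam := lam) hA hb0 hlam0 hlam1 hb x h t
    rw [hzero, hzero, sub_zero, Complex.ofReal_zero] at h2
    calc _ = ∑' q : ℤ × (Fin k → ℤ), c q * unitExp (b ^ (-q.1) * pairing q.2 v * t) *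
          unitExp (-w₀ * t) := by
          refine tsum_congr fun q => ?_
          rw [mul_assoc, ← unitExp_add]
          ring_nf
      _ = 0 := by rw [tsum_mul_right, h2, zero_mul]
  have h2 := tsum_ite_eq_zero_of_forall_tsum_unitExp_eq_zero hcs h1
  set z : ℤ × (Fin k → ℤ) → ℂ := fun q => if b ^ (-q.1) * pairing q.2 v - w₀ = 0 then c q else 0
    with hz
  have hzn : ∀ q, ‖z q‖ ≤ ‖c q‖ := by
    intro q; simp only [hz]; split_ifs <;> simp
  have hzs : Summable z := Summable.of_norm (Summable.of_nonneg_of_le (fun _ => norm_nonneg _) hzn hcs)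
  have hiff : ∀ (n : ℤ) (ξ : Fin k → ℤ), b ^ (-n) * pairing ξ v - w₀ = 0 ↔
      pairing ξ v = b ^ n * w₀ := by
    intro n ξ
    rw [sub_eq_zero, zpow_neg, inv_mul_eq_iff_eq_mul₀ (zpow_ne_zero n hb0)]
  have hval : ∀ (n : ℤ) (ξ : Fin k → ℤ), pairing ξ v = b ^ n * w₀ →
      ‖z (n, ξ)‖ = 2 * (lam ^ n * ‖a ξ‖) := by
    intro n ξ hn
    have h3 : b ^ (-n) * pairing ξ v = w₀ := by
      rw [hn, ← mul_assoc, ← zpow_add₀ hb0]; simp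
    simp only [hz]
    rw [if_pos ((hiff n ξ).2 hn), hc, norm_leafCoeff hlam0]
    simp only
    rw [h3, hh, div_mul_cancel₀ _ hξ₀, unitExp_half]
    norm_num
    ring
  -- Each ξ carries the frequency w₀ for at most one n, because the powers of b are distinct and w₀
  -- ≠ 0.
  have hfib : ∀ (n : ℤ) (ξ : Fin k → ℤ), pairing ξ v = b ^ n * w₀ →
      ∑' m, z (m, ξ) = z (n, ξ) := by
    intro n ξ hn
    refine tsum_eq_single n fun m hm => ?_
    simp only [hz]
    rw [if_neg]
    rw [hiff]
    intro h4
    exact hm (zpow_injective_of_abs_lt_one hb0 hb1 (mul_right_cancel₀ hξ₀ (h4.symm.trans hn)))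
  have hzs' : Summable fun q : (Fin k → ℤ) × ℤ => z q.swap := hzs.prod_symm
  have h3 : ∑' ξ, ∑' n, z (n, ξ) = 0 := by
    rw [← h2, ← (Equiv.prodComm _ _).tsum_eq z]
    exact hzs'.tsum_prod.symm
  have hZs : Summable fun ξ => ∑' n, z (n, ξ) := hzs'.prod
  rw [hZs.tsum_eq_add_tsum_ite ξ₀] at h3
  have hself : pairing ξ₀ v = b ^ (0 : ℤ) * w₀ := by rw [zpow_zero, one_mul]
  have h4 : ‖∑' ξ, (if ξ = ξ₀ then 0 else ∑' n, z (n, ξ))‖ ≤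
      ∑' ξ, 2 * (orbitWeight b v ξ₀ ξ * ‖a ξ‖) := by
    refine tsum_of_norm_bounded ((hF.summable_orbitWeight ξ₀).mul_left 2).hasSum fun ξ => ?_
    split_ifs with hξ
    · rw [norm_zero]
      exact mul_nonneg zero_le_two (mul_nonneg (orbitWeight_nonneg _ _) (norm_nonneg _))
    · by_cases hex : ∃ n : ℤ, pairing ξ v = b ^ n * w₀
      · obtain ⟨n, hn⟩ := hex
        rw [hfib n ξ hn, hval n ξ hn, orbitWeight, if_pos ⟨hξ, n, hn⟩]
        have h5 : |pairing ξ v| / |pairing ξ₀ v| = |b| ^ n := by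
          rw [hn, abs_mul, abs_zpow, ← hw₀, mul_div_cancel_right₀ _ (abs_pos.2 hξ₀).ne']
        rw [h5]
        -- The bound that removes λ: the first summand serves n ≥ 0, the second n ≤ 0, where |b| <
        -- λ.
        have h6 : lam ^ n ≤ 1 + |b| ^ n := by
          obtain ⟨m, rfl | rfl⟩ := n.eq_nat_or_neg
          · have : lam ^ m ≤ 1 := pow_le_one₀ hlam0.le hlam1.le
            rw [zpow_natCast, zpow_natCast]
            linarith [pow_nonneg (abs_nonneg b) m]
          · rw [zpow_neg, zpow_neg, zpow_natCast, zpow_natCast]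
            have h7 : 0 < |b| ^ m := pow_pos (abs_pos.2 hb0) m
            have h8 : |b| ^ m ≤ lam ^ m := pow_le_pow_left₀ (abs_nonneg b) hb.le m
            have := inv_anti₀ h7 h8
            linarith
        gcongr
      · have h5 : ∑' n, z (n, ξ) = 0 := by
          have : ∀ n, z (n, ξ) = 0 := by
            intro n
            simp only [hz]
            rw [if_neg]
            rw [hiff]
            exact fun h => hex ⟨n, h⟩
          simp [this]
        rw [h5, norm_zero]
        exact mul_nonneg zero_le_two (mul_nonneg (orbitWeight_nonneg _ _) (norm_nonneg _))
  rw [hfib 0 ξ₀ hself] at h3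
  have h5 := hval 0 ξ₀ hself
  rw [eq_neg_of_add_eq_zero_left h3, norm_neg, zpow_zero, one_mul] at h5
  rw [h5, tsum_mul_left] at h4
  linarith

end NonVanishing

end SkewGraph

namespace SkewGraph

open UnitAddTorus MeasureTheory

attribute [local instance] instMeasureSpaceUnitAddCircle

local instance isAddHaarMeasure_unitAddCircle :
    Measure.IsAddHaarMeasure (volume : Measure UnitAddCircle) :=
  inferInstanceAs (Measure.IsAddHaarMeasure AddCircle.haarAddCircle)

local instance isProbabilityMeasure_unitAddCircle :
    IsProbabilityMeasure (volume : Measure UnitAddCircle) :=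
  inferInstanceAs (IsProbabilityMeasure AddCircle.haarAddCircle)

/-! ### Fourier coefficients under translation and differentiation. -/

section FourierCoefficients

variable {k : ℕ}

lemma mFourier_neg_mul_self (ξ : Fin k → ℤ) (y : UnitAddTorus (Fin k)) :
    mFourier (-ξ) y * mFourier ξ y = 1 := by
  rw [← mFourier_add, neg_add_cancel, mFourier_zero]; rfl

lemma integrable_of_continuous {g : UnitAddTorus (Fin k) → ℂ} (hg : Continuous g) :
    Integrable g := hg.integrable_of_hasCompactSupport (HasCompactSupport.of_compactSpace g)

lemma continuous_mFourier_mul {g : UnitAddTorus (Fin k) → ℂ} (hg : Continuous g) (ξ : Fin k → ℤ) :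
    Continuous fun x => mFourier ξ x • g x := (mFourier ξ).continuous.smul hg

lemma mFourierCoeff_translate (g : UnitAddTorus (Fin k) → ℂ) (ξ : Fin k → ℤ)
    (y : UnitAddTorus (Fin k)) :
    mFourierCoeff (fun x => g (x + y)) ξ = mFourier ξ y * mFourierCoeff g ξ := by
  rw [mFourierCoeff, mFourierCoeff,
    ← integral_add_right_eq_self (fun x => mFourier (-ξ) x • g x) y, ← integral_const_mul]
  refine integral_congr_ae (ae_of_all _ fun x => ?_)
  simp only [smul_eq_mul]
  rw [mFourier_apply_add]
  linear_combination -(mFourier (-ξ) x * g (x + y)) * mFourier_neg_mul_self ξ y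

/-- Translation by s·w multiplies the coefficient by e(s⟨ξ,w⟩); differentiate this identity at s = 0
under the integral. -/
lemma mFourierCoeff_lineDeriv {g g₁ : UnitAddTorus (Fin k) → ℂ} (hg : Continuous g)
    (hg₁ : Continuous g₁) {w : Fin k → ℝ}
    (h : ∀ x, HasDerivAt (fun s : ℝ => g (x + toTorus (s • w))) (g₁ x) 0) (ξ : Fin k → ℤ) :
    mFourierCoeff g₁ ξ = Complex.I * ((2 * Real.pi * pairing ξ w : ℝ) : ℂ) * mFourierCoeff g ξ := by
  have hT := continuous_toTorus (k := k)
  have h' : ∀ x (s : ℝ), HasDerivAt (fun s : ℝ => g (x + toTorus (s • w)))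
      (g₁ (x + toTorus (s • w))) s := by
    intro x s
    have h1 := HasDerivAt.comp_sub_const s s (f := fun u : ℝ => g (x + toTorus (s • w) +
      toTorus (u • w))) (by rw [sub_self]; exact h (x + toTorus (s • w)))
    simpa only [add_assoc, ← toTorus_add, ← add_smul, add_sub_cancel] using h1
  obtain ⟨C, hC⟩ : ∃ C, ∀ x, ‖g₁ x‖ ≤ C := by
    obtain ⟨C, hC⟩ := isCompact_univ.exists_bound_of_continuousOn hg₁.continuousOn
    exact ⟨C, fun x => hC x (mem_univ x)⟩
  have h1 := (hasDerivAt_integral_of_dominated_loc_of_deriv_le (μ := volume) (x₀ := (0 : ℝ))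
    (F := fun s x => mFourier (-ξ) x • g (x + toTorus (s • w)))
    (F' := fun s x => mFourier (-ξ) x • g₁ (x + toTorus (s • w))) (bound := fun _ => C)
    (s := univ) univ_mem ?_ ?_ ?_ ?_ ?_ ?_).2
  · have h2 : (fun s : ℝ => ∫ x, mFourier (-ξ) x • g (x + toTorus (s • w))) =
        fun s => unitExp (s * pairing ξ w) * mFourierCoeff g ξ := by
      funext s
      rw [← pairing_smul, ← mFourier_toTorus]
      exact mFourierCoeff_translate g ξ _
    rw [h2] at h1
    have h3 : HasDerivAt (fun s : ℝ => unitExp (s * pairing ξ w) * mFourierCoeff g ξ)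
        (Complex.I * ((2 * Real.pi * pairing ξ w : ℝ) : ℂ) * mFourierCoeff g ξ) 0 := by
      have h4 : HasDerivAt (fun s : ℝ => Complex.I * ((2 * Real.pi * (s * pairing ξ w) : ℝ) : ℂ))
          (Complex.I * ((2 * Real.pi * pairing ξ w : ℝ) : ℂ)) 0 := by
        have h5 : HasDerivAt (fun s : ℝ => 2 * Real.pi * (s * pairing ξ w))
            (2 * Real.pi * pairing ξ w) 0 := by
          simpa using ((hasDerivAt_id (0 : ℝ)).mul_const (pairing ξ w)).const_mul (2 * Real.pi)
        exact h5.ofReal_comp.const_mul _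
      simpa [unitExp] using h4.cexp.mul_const (mFourierCoeff g ξ)
    have h6 := h1.unique h3
    simpa [mFourierCoeff, toTorus_zero] using h6
  · exact Eventually.of_forall fun s => (continuous_mFourier_mul
      (g := fun x => g (x + toTorus (s • w))) (by fun_prop) _).aestronglyMeasurable
  · exact integrable_of_continuous (continuous_mFourier_mul
      (g := fun x => g (x + toTorus ((0 : ℝ) • w))) (by fun_prop) _)
  · exact (continuous_mFourier_mul
      (g := fun x => g₁ (x + toTorus ((0 : ℝ) • w))) (by fun_prop) _).aestronglyMeasurable
  · refine ae_of_all _ fun x s _ => ?_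
    rw [norm_smul, norm_mFourier_apply, one_mul]
    exact hC _
  · exact integrable_const C
  · exact ae_of_all _ fun x s _ => by simpa only [smul_eq_mul] using (h' x s).const_mul _

lemma summable_sq_mFourierCoeff_of_continuous {g : UnitAddTorus (Fin k) → ℂ} (hg : Continuous g) {C : ℝ}
    (hC : ∀ x, ‖g x‖ ≤ C) :
    Summable (fun ξ => ‖mFourierCoeff g ξ‖ ^ 2) ∧ ∑' ξ, ‖mFourierCoeff g ξ‖ ^ 2 ≤ C ^ 2 := by
  have h := hasSum_sq_mFourierCoeff (ContinuousMap.toLp 2 volume ℂ (⟨g, hg⟩ : C(UnitAddTorus (Fin k), ℂ)))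
  simp only [mFourierCoeff_toLp, ContinuousMap.coe_mk] at h
  refine ⟨h.summable, ?_⟩
  rw [h.tsum_eq]
  have h1 : ∫ t, ‖(ContinuousMap.toLp 2 volume ℂ (⟨g, hg⟩ : C(UnitAddTorus (Fin k), ℂ))) t‖ ^ 2 =
      ∫ t, ‖g t‖ ^ 2 := by
    refine integral_congr_ae ?_
    filter_upwards [ContinuousMap.coeFn_toLp (p := 2) (𝕜 := ℂ) volume
      (⟨g, hg⟩ : C(UnitAddTorus (Fin k), ℂ))] with t ht
    rw [ht]; rfl
  rw [h1]
  have h2 : ∫ t, ‖g t‖ ^ 2 ≤ ∫ _ : UnitAddTorus (Fin k), C ^ 2 := by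
    refine integral_mono_of_nonneg (ae_of_all _ fun t => by positivity) (integrable_const _)
      (ae_of_all _ fun t => ?_)
    exact pow_le_pow_left₀ (norm_nonneg _) (hC t) 2
  simpa using h2

end FourierCoefficients

/-! ### Directional derivatives and Parseval. -/

section LineDerivatives

variable {k : ℕ}

/-- The `m`-th derivative of `p` in the direction `w`. -/
noncomputable def lineIteratedDeriv (p : UnitAddTorus (Fin k) → ℝ) (w : Fin k → ℝ) (m : ℕ)
    (x : UnitAddTorus (Fin k)) : ℝ :=
  iteratedDeriv m (fun s : ℝ => p (x + toTorus (s • w))) 0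

lemma iteratedDeriv_line {P : (Fin k → ℝ) → ℝ} {r m : ℕ} (hP : ContDiff ℝ r P) (hm : m ≤ r)
    (x w : Fin k → ℝ) (s : ℝ) :
    iteratedDeriv m (fun s : ℝ => P (x + s • w)) s = iteratedFDeriv ℝ m P (x + s • w) fun _ => w := by
  have h1 : (fun s : ℝ => P (x + s • w)) =
      (fun z => P (x + z)) ∘ (ContinuousLinearMap.toSpanSingleton ℝ w) := by
    funext s; simp
  have h2 : ContDiff ℝ r fun z => P (x + z) := hP.comp (contDiff_const.add contDiff_id)
  rw [iteratedDeriv_eq_iteratedFDeriv, h1,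
    ContinuousLinearMap.iteratedFDeriv_comp_right _ h2 _ (by exact_mod_cast hm),
    iteratedFDeriv_comp_add_left]
  simp

variable {p : UnitAddTorus (Fin k) → ℝ} {r : ℕ}

lemma lineIteratedDeriv_add_line (hp : ContDiff ℝ r fun x : Fin k → ℝ => p (toTorus x)) {m : ℕ}
    (hm : m ≤ r) (w x : Fin k → ℝ) (s : ℝ) :
    lineIteratedDeriv p w m (toTorus x + toTorus (s • w)) =
      iteratedDeriv m (fun s : ℝ => p (toTorus (x + s • w))) s := by
  rw [lineIteratedDeriv]
  have h1 : (fun u : ℝ => p (toTorus x + toTorus (s • w) + toTorus (u • w))) =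
      fun u : ℝ => p (toTorus (x + s • w + u • w)) := by
    funext u; rw [toTorus_add, toTorus_add]
  rw [h1, iteratedDeriv_line hp hm, iteratedDeriv_line hp hm]
  simp

lemma lineIteratedDeriv_toTorus (hp : ContDiff ℝ r fun x : Fin k → ℝ => p (toTorus x)) {m : ℕ}
    (hm : m ≤ r) (w x : Fin k → ℝ) :
    lineIteratedDeriv p w m (toTorus x) =
      iteratedFDeriv ℝ m (fun x : Fin k → ℝ => p (toTorus x)) x fun _ => w := by
  have h := lineIteratedDeriv_add_line hp hm w x 0
  rw [iteratedDeriv_line hp hm] at h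
  simpa [toTorus_zero] using h

lemma continuous_lineIteratedDeriv (hp : ContDiff ℝ r fun x : Fin k → ℝ => p (toTorus x)) {m : ℕ}
    (hm : m ≤ r) (w : Fin k → ℝ) : Continuous (lineIteratedDeriv p w m) := by
  rw [isOpenQuotientMap_toTorus.isQuotientMap.continuous_iff]
  have h : lineIteratedDeriv p w m ∘ toTorus =
      fun x => iteratedFDeriv ℝ m (fun x : Fin k → ℝ => p (toTorus x)) x fun _ => w :=
    funext fun x => lineIteratedDeriv_toTorus hp hm w x
  rw [h]
  exact (hp.continuous_iteratedFDeriv (by exact_mod_cast hm)).eval_const _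

lemma hasDerivAt_lineIteratedDeriv (hp : ContDiff ℝ r fun x : Fin k → ℝ => p (toTorus x)) {m : ℕ}
    (hm : m < r) (w : Fin k → ℝ) (x : UnitAddTorus (Fin k)) :
    HasDerivAt (fun s : ℝ => lineIteratedDeriv p w m (x + toTorus (s • w)))
      (lineIteratedDeriv p w (m + 1) x) 0 := by
  obtain ⟨x, rfl⟩ := isOpenQuotientMap_toTorus.surjective x
  have h1 := lineIteratedDeriv_add_line hp (Nat.succ_le_of_lt hm) w x 0
  rw [zero_smul, toTorus_zero, add_zero] at h1
  rw [h1, iteratedDeriv_succ]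
  simp only [lineIteratedDeriv_add_line hp hm.le]
  have h2 : ContDiff ℝ r fun s : ℝ => p (toTorus (x + s • w)) :=
    hp.comp (contDiff_const.add (contDiff_id.smul contDiff_const))
  exact (h2.differentiable_iteratedDeriv m (by exact_mod_cast hm) 0).hasDerivAt

lemma mFourierCoeff_lineIteratedDeriv (hp : ContDiff ℝ r fun x : Fin k → ℝ => p (toTorus x)) {m : ℕ}
    (hm : m ≤ r) (w : Fin k → ℝ) (ξ : Fin k → ℤ) :
    mFourierCoeff (fun x => (lineIteratedDeriv p w m x : ℂ)) ξ =
      (Complex.I * ((2 * Real.pi * pairing ξ w : ℝ) : ℂ)) ^ m *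
        mFourierCoeff (fun x => (p x : ℂ)) ξ := by
  induction m with
  | zero => simp [lineIteratedDeriv, toTorus_zero]
  | succ m ih =>
    have h := mFourierCoeff_lineDeriv
      (Complex.continuous_ofReal.comp (continuous_lineIteratedDeriv hp (Nat.le_of_succ_le hm) w))
      (Complex.continuous_ofReal.comp (continuous_lineIteratedDeriv hp hm w))
      (fun x => (hasDerivAt_lineIteratedDeriv hp hm w x).ofReal_comp) ξ
    simp only [Function.comp_def] at h
    rw [h, ih (Nat.le_of_succ_le hm), pow_succ]
    ring

/-- Parseval for the m-th derivative along `w`, whose coefficients carry the factor (2πi⟨ξ,w⟩)^m;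
the factor 2π ≥ 1 is dropped. -/
lemma summable_sq_pairing_mul_mFourierCoeff
    (hp : ContDiff ℝ r fun x : Fin k → ℝ => p (toTorus x)) {m : ℕ} (hm : m ≤ r) {δ : ℝ}
    (hδ : ∀ x, ‖iteratedFDeriv ℝ m (fun x : Fin k → ℝ => p (toTorus x)) x‖ ≤ δ)
    {w : Fin k → ℝ} (hw : ‖w‖ ≤ 1) :
    Summable (fun ξ => (|pairing ξ w| ^ m * ‖mFourierCoeff (fun x => (p x : ℂ)) ξ‖) ^ 2) ∧
      ∑' ξ, (|pairing ξ w| ^ m * ‖mFourierCoeff (fun x => (p x : ℂ)) ξ‖) ^ 2 ≤ δ ^ 2 := by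
  have hδ0 : 0 ≤ δ := (norm_nonneg _).trans (hδ 0)
  have h1 := summable_sq_mFourierCoeff_of_continuous (C := δ)
    (Complex.continuous_ofReal.comp (continuous_lineIteratedDeriv hp hm w)) ?_
  · have h2 : ∀ ξ, (|pairing ξ w| ^ m * ‖mFourierCoeff (fun x => (p x : ℂ)) ξ‖) ^ 2 ≤
        ‖mFourierCoeff (Complex.ofReal ∘ lineIteratedDeriv p w m) ξ‖ ^ 2 := by
      intro ξ
      have h3 := mFourierCoeff_lineIteratedDeriv hp hm w ξ
      rw [Function.comp_def, h3, norm_mul, norm_pow, norm_mul, Complex.norm_I, one_mul,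
        Complex.norm_real, Real.norm_eq_abs, abs_mul, abs_of_pos Real.two_pi_pos]
      gcongr
      nlinarith [Real.pi_gt_three, abs_nonneg (pairing ξ w)]
    have hs := Summable.of_nonneg_of_le (fun ξ => by positivity) h2 h1.1
    exact ⟨hs, (hs.tsum_le_tsum h2 h1.1).trans h1.2⟩
  · intro x
    obtain ⟨x, rfl⟩ := isOpenQuotientMap_toTorus.surjective x
    rw [Function.comp_apply, Complex.norm_real, lineIteratedDeriv_toTorus hp hm]
    refine (ContinuousMultilinearMap.le_opNorm _ _).trans ?_
    rw [Finset.prod_const]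
    calc _ ≤ δ * 1 := by
          gcongr
          · exact hδ x
          · exact pow_le_one₀ (norm_nonneg _) hw
      _ = δ := mul_one δ

end LineDerivatives

/-! ### Lattice sums. -/

section Summability

lemma summable_prod_pi {f : ℤ → ℝ} (h0 : ∀ n, 0 ≤ f n) (hf : Summable f) (k : ℕ) :
    Summable fun ξ : Fin k → ℤ => ∏ i, f (ξ i) := by
  induction k with
  | zero => exact Summable.of_finite
  | succ k ih =>
    rw [← (Fin.consEquiv fun _ => ℤ).summable_iff]
    refine (hf.mul_of_nonneg ih h0 fun ξ => Finset.prod_nonneg fun i _ => h0 _).congr fun q => ?_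
    simp [Fin.consEquiv, Fin.prod_univ_succ]

/-- The sup norm bounds every coordinate, so the sum is dominated by a product of k convergent
one-dimensional sums. -/
lemma summable_inv_one_add_norm_pow (k : ℕ) :
    Summable fun ξ : Fin k → ℤ => ((1 + ‖ξ‖) ^ (2 * k))⁻¹ := by
  have h1 : Summable fun n : ℤ => ((1 + |(n : ℝ)|) ^ 2)⁻¹ := by
    have h2 : Summable fun n : ℕ => ((1 + (n : ℝ)) ^ 2)⁻¹ := by
      have := (summable_nat_add_iff 1).2 (Real.summable_nat_pow_inv.2 (one_lt_two : 1 < 2))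
      refine this.congr fun n => ?_
      push_cast; ring_nf
    exact Summable.of_nat_of_neg (by simpa using h2) (by simpa using h2)
  refine Summable.of_nonneg_of_le (fun ξ => by positivity) (fun ξ => ?_)
    (summable_prod_pi (fun n => by positivity) h1 k)
  rw [Finset.prod_inv_distrib]
  refine inv_anti₀ (Finset.prod_pos fun i _ => by positivity) ?_
  calc ∏ i, (1 + |(ξ i : ℝ)|) ^ 2 ≤ ∏ _i : Fin k, (1 + ‖ξ‖) ^ 2 := by
        refine Finset.prod_le_prod (fun i _ => by positivity) fun i _ => ?_
        have h := norm_le_pi_norm ξ i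
        rw [Int.norm_eq_abs] at h
        gcongr
    _ = (1 + ‖ξ‖) ^ (2 * k) := by simp [pow_mul]

lemma one_add_norm_pow_le {k : ℕ} (ξ : Fin k → ℤ) (m : ℕ) :
    (1 + ‖ξ‖) ^ m ≤ 2 ^ m * (1 + ∑ i, |(ξ i : ℝ)| ^ m) := by
  have hsum : 0 ≤ ∑ i, |(ξ i : ℝ)| ^ m := Finset.sum_nonneg fun i _ => by positivity
  rcases le_or_gt ‖ξ‖ 1 with h | h
  · calc (1 + ‖ξ‖) ^ m ≤ 2 ^ m := by gcongr; linarith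
      _ ≤ _ := by nlinarith [pow_pos (two_pos : (0 : ℝ) < 2) m]
  · obtain ⟨i, hi⟩ : ∃ i, ‖ξ‖ ≤ |(ξ i : ℝ)| := by
      by_contra! hcon
      have h2 : ‖ξ‖ < ‖ξ‖ := (pi_norm_lt_iff (by linarith)).2 fun i => by
        rw [Int.norm_eq_abs]; exact hcon i
      exact lt_irrefl _ h2
    have h3 := Finset.single_le_sum (f := fun i => |(ξ i : ℝ)| ^ m) (fun i _ => by positivity)
      (Finset.mem_univ i)
    calc (1 + ‖ξ‖) ^ m ≤ (2 * |(ξ i : ℝ)|) ^ m := by gcongr; linarith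
      _ = 2 ^ m * |(ξ i : ℝ)| ^ m := mul_pow _ _ _
      _ ≤ _ := by gcongr; linarith

end Summability

/-! ### The embedding of Cᵏ⁺¹ into the weighted Fourier algebra. -/

section Embedding

/-- The norm of the embedding of `Cᵏ⁺¹` into the weighted Fourier algebra is at most this. -/
noncomputable def embeddingConst (k : ℕ) : ℝ :=
  (∑' ξ : Fin k → ℤ, ((1 + ‖ξ‖) ^ (2 * k))⁻¹ + 2 ^ (2 * (k + 1)) * (1 + k)) / 2

variable {k : ℕ} {p : UnitAddTorus (Fin k) → ℝ}

lemma pairing_single (ξ : Fin k → ℤ) (i : Fin k) : pairing ξ (Pi.single i 1) = ξ i := by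
  simp [pairing, Pi.single_apply]

/-- With u = 1 + ‖ξ‖, write u·y = u⁻ᵏ · (uᵏ⁺¹y). The squares of the first factor are summable over
ℤᵏ; those of the second are controlled by Parseval for the derivatives of order 0 and k + 1 along
the coordinate axes. -/
lemma summable_weighted_mFourierCoeff
    (hp : ContDiff ℝ (k + 1 : ℕ) fun x : Fin k → ℝ => p (toTorus x)) {δ : ℝ} (hδ0 : 0 < δ)
    (hδ : ∀ m ≤ k + 1, ∀ x, ‖iteratedFDeriv ℝ m (fun x : Fin k → ℝ => p (toTorus x)) x‖ ≤ δ) :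
    Summable (fun ξ => (1 + ‖ξ‖) * ‖mFourierCoeff (fun x => (p x : ℂ)) ξ‖) ∧
      ∑' ξ, (1 + ‖ξ‖) * ‖mFourierCoeff (fun x => (p x : ℂ)) ξ‖ ≤ embeddingConst k * δ := by
  set y : (Fin k → ℤ) → ℝ := fun ξ => ‖mFourierCoeff (fun x => (p x : ℂ)) ξ‖ with hy
  have h0 := summable_sq_pairing_mul_mFourierCoeff hp (Nat.zero_le _) (hδ 0 (Nat.zero_le _))
    (w := 0) (by simp)
  simp only [pow_zero, one_mul] at h0
  have h1 : ∀ i : Fin k, _ := fun i => summable_sq_pairing_mul_mFourierCoeff hp le_rfl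
    (hδ (k + 1) le_rfl) (w := Pi.single i 1) (by
      rw [pi_norm_le_iff_of_nonneg zero_le_one]
      intro j
      by_cases h : j = i
      · subst h; simp
      · simp [h])
  simp only [pairing_single] at h1
  have h2 := summable_inv_one_add_norm_pow k
  set D : (Fin k → ℤ) → ℝ := fun ξ =>
    2 ^ (2 * (k + 1)) * (y ξ ^ 2 + ∑ i, (|(ξ i : ℝ)| ^ (k + 1) * y ξ) ^ 2) with hD
  have hDs : Summable D := (h0.1.add (summable_sum fun i _ => (h1 i).1)).mul_left _
  have hDt : ∑' ξ, D ξ ≤ 2 ^ (2 * (k + 1)) * (1 + k) * δ ^ 2 := by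
    rw [hD, tsum_mul_left, h0.1.tsum_add (summable_sum fun i _ => (h1 i).1),
      Summable.tsum_finsetSum fun i _ => (h1 i).1, mul_assoc]
    gcongr
    have h3 := Finset.sum_le_card_nsmul Finset.univ _ (δ ^ 2) fun i _ => (h1 i).2
    rw [Finset.card_univ, Fintype.card_fin, nsmul_eq_mul] at h3
    linarith [h0.2]
  -- Young's inequality weighted by δ: since ∑ D is of order δ², both sums are of order δ, as a
  -- linear bound requires.
  have hle : ∀ ξ, (1 + ‖ξ‖) * y ξ ≤ δ / 2 * ((1 + ‖ξ‖) ^ (2 * k))⁻¹ + 1 / (2 * δ) * D ξ := by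
    intro ξ
    have h3 : (1 + ‖ξ‖) ^ (2 * (k + 1)) * y ξ ^ 2 ≤ D ξ := by
      have h4 := one_add_norm_pow_le ξ (2 * (k + 1))
      calc _ ≤ 2 ^ (2 * (k + 1)) * (1 + ∑ i, |(ξ i : ℝ)| ^ (2 * (k + 1))) * y ξ ^ 2 := by gcongr
        _ = D ξ := by
          simp only [hD]
          rw [mul_assoc, add_mul, Finset.sum_mul, one_mul]
          congr 2
          exact Finset.sum_congr rfl fun i _ => by rw [mul_pow, ← pow_mul, mul_comm (k + 1)]
    set u := 1 + ‖ξ‖ with hu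
    have hu0 : 0 < u := by positivity
    have h4 : u * y ξ = (u ^ k)⁻¹ * (u ^ (k + 1) * y ξ) := by
      rw [pow_succ]; field_simp
    have h5 : (u ^ (2 * k))⁻¹ = ((u ^ k)⁻¹) ^ 2 := by rw [inv_pow, ← pow_mul, mul_comm]
    have h6 : u ^ (2 * (k + 1)) * y ξ ^ 2 = (u ^ (k + 1) * y ξ) ^ 2 := by
      rw [mul_pow, ← pow_mul, mul_comm 2]
    rw [h6] at h3
    rw [h4, h5]
    have h7 : (u ^ k)⁻¹ * (u ^ (k + 1) * y ξ) ≤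
        δ / 2 * ((u ^ k)⁻¹) ^ 2 + 1 / (2 * δ) * (u ^ (k + 1) * y ξ) ^ 2 := by
      have h8 : δ / 2 * ((u ^ k)⁻¹) ^ 2 + 1 / (2 * δ) * (u ^ (k + 1) * y ξ) ^ 2
          - (u ^ k)⁻¹ * (u ^ (k + 1) * y ξ) =
          1 / (2 * δ) * (δ * (u ^ k)⁻¹ - u ^ (k + 1) * y ξ) ^ 2 := by
        field_simp; ring
      have h9 : 0 ≤ 1 / (2 * δ) * (δ * (u ^ k)⁻¹ - u ^ (k + 1) * y ξ) ^ 2 := by positivity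
      linarith
    refine h7.trans ?_
    gcongr
  have hs' := (h2.mul_left (δ / 2)).add (hDs.mul_left (1 / (2 * δ)))
  have hs := Summable.of_nonneg_of_le (fun ξ => by positivity) hle hs'
  refine ⟨hs, (hs.tsum_le_tsum hle hs').trans ?_⟩
  rw [(h2.mul_left (δ / 2)).tsum_add (hDs.mul_left (1 / (2 * δ))), tsum_mul_left, tsum_mul_left,
    embeddingConst]
  have h3 : 1 / (2 * δ) * ∑' ξ, D ξ ≤ 2 ^ (2 * (k + 1)) * (1 + k) / 2 * δ := by
    calc _ ≤ 1 / (2 * δ) * (2 ^ (2 * (k + 1)) * (1 + k) * δ ^ 2) := by gcongr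
      _ = _ := by field_simp
  linarith

lemma continuous_of_contDiff_lift {r : ℕ} (hp : ContDiff ℝ r fun x : Fin k → ℝ => p (toTorus x)) :
    Continuous p :=
  isOpenQuotientMap_toTorus.isQuotientMap.continuous_iff.2 hp.continuous

theorem hasFourier_of_contDiff
    (hp : ContDiff ℝ (k + 1 : ℕ) fun x : Fin k → ℝ => p (toTorus x)) {δ : ℝ} (hδ0 : 0 < δ)
    (hδ : ∀ m ≤ k + 1, ∀ x, ‖iteratedFDeriv ℝ m (fun x : Fin k → ℝ => p (toTorus x)) x‖ ≤ δ) :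
    HasFourier p (mFourierCoeff fun x => (p x : ℂ)) := by
  have hc := continuous_of_contDiff_lift hp
  have hs := (summable_weighted_mFourierCoeff hp hδ0 hδ).1
  refine ⟨hc, hs, fun x => ?_⟩
  let f : C(UnitAddTorus (Fin k), ℂ) := ⟨fun x => (p x : ℂ), Complex.continuous_ofReal.comp hc⟩
  have hs2 : Summable (mFourierCoeff f) := by
    refine Summable.of_norm (Summable.of_nonneg_of_le (fun _ => norm_nonneg _) (fun ξ => ?_) hs)
    have h := norm_nonneg (mFourierCoeff (fun x => (p x : ℂ)) ξ)
    change ‖mFourierCoeff (fun x => (p x : ℂ)) ξ‖ ≤ _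
    nlinarith [norm_nonneg ξ, mul_nonneg (norm_nonneg ξ) h]
  exact hasSum_mFourier_series_apply_of_summable hs2 x

lemma mFourierCoeff_sub {f g : UnitAddTorus (Fin k) → ℂ} (hf : Continuous f) (hg : Continuous g)
    (ξ : Fin k → ℤ) :
    mFourierCoeff (fun x => f x - g x) ξ = mFourierCoeff f ξ - mFourierCoeff g ξ := by
  rw [mFourierCoeff, mFourierCoeff, mFourierCoeff,
    ← integral_sub (integrable_of_continuous (continuous_mFourier_mul hf _))
      (integrable_of_continuous (continuous_mFourier_mul hg _))]
  simp only [smul_sub]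

lemma mFourierCoeff_add {f g : UnitAddTorus (Fin k) → ℂ} (hf : Continuous f) (hg : Continuous g)
    (ξ : Fin k → ℤ) :
    mFourierCoeff (fun x => f x + g x) ξ = mFourierCoeff f ξ + mFourierCoeff g ξ := by
  rw [mFourierCoeff, mFourierCoeff, mFourierCoeff,
    ← integral_add (integrable_of_continuous (continuous_mFourier_mul hf _))
      (integrable_of_continuous (continuous_mFourier_mul hg _))]
  simp only [smul_add]

lemma mFourierCoeff_sum {ι : Type*} (s : Finset ι) {f : ι → UnitAddTorus (Fin k) → ℂ}
    (hf : ∀ i ∈ s, Continuous (f i)) (ξ : Fin k → ℤ) :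
    mFourierCoeff (fun x => ∑ i ∈ s, f i x) ξ = ∑ i ∈ s, mFourierCoeff (f i) ξ := by
  simp only [mFourierCoeff]
  rw [← integral_finsetSum s fun i hi =>
    integrable_of_continuous (continuous_mFourier_mul (hf i hi) _)]
  simp only [Finset.smul_sum]

lemma mFourierCoeff_const_mul (c : ℂ) (f : UnitAddTorus (Fin k) → ℂ) (ξ : Fin k → ℤ) :
    mFourierCoeff (fun x => c * f x) ξ = c * mFourierCoeff f ξ := by
  rw [mFourierCoeff, mFourierCoeff, ← integral_const_mul]
  refine integral_congr_ae (ae_of_all _ fun x => ?_)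
  simp only [smul_eq_mul]
  ring

lemma mFourierCoeff_mFourier (ξ η : Fin k → ℤ) :
    mFourierCoeff (fun x => mFourier η x) ξ = if ξ = η then 1 else 0 := by
  have h := orthonormal_iff_ite.1 (orthonormal_mFourier (d := Fin k)) ξ η
  rw [← h, ContinuousMap.inner_toLp, mFourierCoeff]
  refine integral_congr_ae (ae_of_all _ fun x => ?_)
  simp only [smul_eq_mul, mFourier_neg]
  exact mul_comm _ _

end Embedding

end SkewGraph

namespace SkewGraph

open UnitAddTorus

/-! ### Neighbourhoods and translations in the Cʳ topology. -/

section CrTopology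

variable {k r : ℕ}

/-- The lift to `ℝᵏ` of a function on the torus. -/
abbrev torusLift (p : UnitAddTorus (Fin k) → ℝ) (x : Fin k → ℝ) : ℝ := p (toTorus x)

lemma nhds_crTorus (q : CrTorus k r) :
    𝓝 q = ⨅ m : Fin (r + 1), comap (fun p : CrTorus k r =>
      UniformFun.ofFun (iteratedFDeriv ℝ (m : ℕ) (torusLift p.1)))
      (𝓝 (UniformFun.ofFun (iteratedFDeriv ℝ (m : ℕ) (torusLift q.1)))) := by
  change @nhds _ (⨅ m : Fin (r + 1), TopologicalSpace.induced _ _) q = _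
  rw [nhds_iInf]
  simp only [nhds_induced]

lemma eventually_norm_iteratedFDeriv_sub_lt (q : CrTorus k r) {δ : ℝ} (hδ : 0 < δ) :
    ∀ᶠ p : CrTorus k r in 𝓝 q, ∀ m ≤ r, ∀ x,
      ‖iteratedFDeriv ℝ m (torusLift p.1) x - iteratedFDeriv ℝ m (torusLift q.1) x‖ < δ := by
  have h : ∀ m : Fin (r + 1), ∀ᶠ p : CrTorus k r in 𝓝 q, ∀ x,
      ‖iteratedFDeriv ℝ m (torusLift p.1) x - iteratedFDeriv ℝ m (torusLift q.1) x‖ < δ := by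
    intro m
    rw [nhds_crTorus]
    refine mem_iInf_of_mem m (mem_comap.2 ⟨_, (UniformFun.hasBasis_nhds _ _ _).mem_of_mem
      (Metric.dist_mem_uniformity hδ), ?_⟩)
    intro p hp x
    have h1 := hp x
    rw [← dist_eq_norm, dist_comm]
    exact h1
  filter_upwards [eventually_all.2 h] with p hp m hm x
  exact hp ⟨m, Nat.lt_succ_of_le hm⟩ x

lemma exists_mem_of_mem_nhds_crTorus {q : CrTorus k r} {s : Set (CrTorus k r)} (hs : s ∈ 𝓝 q) :
    ∃ δ, 0 < δ ∧ ∀ p : CrTorus k r, (∀ m ≤ r, ∀ x,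
      ‖iteratedFDeriv ℝ m (torusLift p.1) x - iteratedFDeriv ℝ m (torusLift q.1) x‖ < δ) →
      p ∈ s := by
  rw [nhds_crTorus, mem_iInf_of_finite] at hs
  obtain ⟨t, ht, rfl⟩ := hs
  have h : ∀ m : Fin (r + 1), ∃ δ, 0 < δ ∧ ∀ p : CrTorus k r, (∀ x,
      ‖iteratedFDeriv ℝ m (torusLift p.1) x - iteratedFDeriv ℝ m (torusLift q.1) x‖ < δ) →
      p ∈ t m := by
    intro m
    obtain ⟨u, hu, hut⟩ := mem_comap.1 (ht m)
    obtain ⟨V, hV, hVu⟩ := (UniformFun.hasBasis_nhds _ _ _).mem_iff.1 hu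
    obtain ⟨δ, hδ, hδV⟩ := Metric.mem_uniformity_dist.1 hV
    refine ⟨δ, hδ, fun p hp => hut (hVu fun x => hδV ?_)⟩
    rw [dist_comm, dist_eq_norm]
    exact hp x
  choose δ hδ hδt using h
  refine ⟨Finset.univ.inf' Finset.univ_nonempty δ, by simpa using hδ, fun p hp => mem_iInter.2
    fun m => hδt m p fun x => ?_⟩
  exact (hp m (Nat.le_of_lt_succ m.2) x).trans_le (Finset.inf'_le _ (Finset.mem_univ m))

variable {p : UnitAddTorus (Fin k) → ℝ}

/-- Derivatives of a periodic function are periodic. Descending to the compact torus gives their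
boundedness and uniform continuity. -/
lemma exists_continuous_lift_eq_iteratedFDeriv (hp : ContDiff ℝ r (torusLift p)) {m : ℕ}
    (hm : m ≤ r) : ∃ h : UnitAddTorus (Fin k) → ((Fin k → ℝ) [×m]→L[ℝ] ℝ), Continuous h ∧
      ∀ x, h (toTorus x) = iteratedFDeriv ℝ m (torusLift p) x := by
  have hper : ∀ x y : Fin k → ℝ, toTorus x = toTorus y →
      iteratedFDeriv ℝ m (torusLift p) x = iteratedFDeriv ℝ m (torusLift p) y := by
    intro x y hxy
    have hz : toTorus (x - y) = 0 := by
      have h1 := toTorus_add (x - y) y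
      rw [sub_add_cancel, hxy] at h1
      exact left_eq_add.1 (by rw [add_comm]; exact h1)
    have h2 : (fun z => torusLift p (z + (x - y))) = torusLift p := by
      funext z
      rw [torusLift, toTorus_add, hz, add_zero]
    have h3 := iteratedFDeriv_comp_add_right (𝕜 := ℝ) (f := torusLift p) m (x - y) y
    rw [h2, add_sub_cancel] at h3
    exact h3.symm
  have hsurj := isOpenQuotientMap_toTorus (k := k).surjective
  refine ⟨fun x => iteratedFDeriv ℝ m (torusLift p) (Function.surjInv hsurj x), ?_, ?_⟩
  · rw [isOpenQuotientMap_toTorus.isQuotientMap.continuous_iff]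
    have h : (fun x => iteratedFDeriv ℝ m (torusLift p) (Function.surjInv hsurj x)) ∘ toTorus =
        iteratedFDeriv ℝ m (torusLift p) :=
      funext fun x => hper _ _ (Function.surjInv_eq hsurj _)
    rw [h]
    exact hp.continuous_iteratedFDeriv (by exact_mod_cast hm)
  · exact fun x => hper _ _ (Function.surjInv_eq hsurj _)

lemma exists_bound_iteratedFDeriv (hp : ContDiff ℝ r (torusLift p)) :
    ∃ C, 0 < C ∧ ∀ m ≤ r, ∀ x, ‖iteratedFDeriv ℝ m (torusLift p) x‖ ≤ C := by
  have h : ∀ m : Fin (r + 1), ∃ C, ∀ x, ‖iteratedFDeriv ℝ m (torusLift p) x‖ ≤ C := by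
    intro m
    obtain ⟨h, hc, hh⟩ := exists_continuous_lift_eq_iteratedFDeriv hp (Nat.le_of_lt_succ m.2)
    obtain ⟨C, hC⟩ := isCompact_univ.exists_bound_of_continuousOn hc.continuousOn
    exact ⟨C, fun x => by rw [← hh]; exact hC _ (mem_univ _)⟩
  choose C hC using h
  refine ⟨1 + ∑ m, |C m|, by positivity, fun m hm x => ?_⟩
  have h1 := hC ⟨m, Nat.lt_succ_of_le hm⟩ x
  have h2 := Finset.single_le_sum (f := fun m => |C m|) (fun i _ => abs_nonneg _)
    (Finset.mem_univ (⟨m, Nat.lt_succ_of_le hm⟩ : Fin (r + 1)))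
  have h3 := le_abs_self (C ⟨m, Nat.lt_succ_of_le hm⟩)
  simp only at h1 h2
  linarith

lemma eventually_norm_iteratedFDeriv_translate_sub_lt (hp : ContDiff ℝ r (torusLift p)) {δ : ℝ}
    (hδ : 0 < δ) :
    ∀ᶠ σ : Fin k → ℝ in 𝓝 0, ∀ m ≤ r, ∀ x,
      ‖iteratedFDeriv ℝ m (torusLift p) (x + σ) - iteratedFDeriv ℝ m (torusLift p) x‖ < δ := by
  have h : ∀ m : Fin (r + 1), ∀ᶠ σ : Fin k → ℝ in 𝓝 0, ∀ x,
      ‖iteratedFDeriv ℝ m (torusLift p) (x + σ) - iteratedFDeriv ℝ m (torusLift p) x‖ < δ := by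
    intro m
    obtain ⟨h, hc, hh⟩ := exists_continuous_lift_eq_iteratedFDeriv hp (Nat.le_of_lt_succ m.2)
    have hT := continuous_toTorus (k := k)
    have h1 : ∀ᶠ σ : Fin k → ℝ in 𝓝 0, ∀ y ∈ (univ : Set (UnitAddTorus (Fin k))),
        ‖h (y + toTorus σ) - h y‖ < δ := by
      refine isCompact_univ.eventually_forall_of_forall_eventually fun y _ => ?_
      have h2 : Continuous fun z : (Fin k → ℝ) × UnitAddTorus (Fin k) =>
          ‖h (z.2 + toTorus z.1) - h z.2‖ := by fun_prop
      refine (h2.tendsto (0, y)).eventually_lt_const ?_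
      simpa [toTorus_zero] using hδ
    filter_upwards [h1] with σ hσ x
    have h3 := hσ (toTorus x) (mem_univ _)
    rwa [← toTorus_add, hh, hh] at h3
  filter_upwards [eventually_all.2 h] with σ hσ m hm x
  exact hσ ⟨m, Nat.lt_succ_of_le hm⟩ x

end CrTopology

/-! ### Integer vectors on one orbit of frequencies. -/

section Lattice

variable {k : ℕ} {A : Matrix.GeneralLinearGroup (Fin k) ℤ} {b : ℝ} {v : Fin k → ℝ}

lemma pairing_add (ξ η : Fin k → ℤ) (w : Fin k → ℝ) :
    pairing (ξ + η) w = pairing ξ w + pairing η w := by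
  simp [pairing, add_mul, Finset.sum_add_distrib]

lemma pairing_sub (ξ η : Fin k → ℤ) (w : Fin k → ℝ) :
    pairing (ξ - η) w = pairing ξ w - pairing η w := by
  simp [pairing, sub_mul, Finset.sum_sub_distrib]

lemma pairing_zsmul (n : ℤ) (ξ : Fin k → ℤ) (w : Fin k → ℝ) :
    pairing (n • ξ) w = n * pairing ξ w := by
  simp [pairing, Finset.mul_sum, mul_assoc]

lemma pairing_neg (ξ : Fin k → ℤ) (w : Fin k → ℝ) : pairing (-ξ) w = -pairing ξ w := by
  simp [pairing]

lemma pairing_intCast (ξ u : Fin k → ℤ) : pairing ξ (fun i => (u i : ℝ)) = ((ξ ⬝ᵥ u : ℤ) : ℝ) := by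
  simp [pairing, dotProduct]

lemma pairing_vecMul (ξ : Fin k → ℤ) (N : Matrix (Fin k) (Fin k) ℤ) (w : Fin k → ℝ) :
    pairing (ξ ᵥ* N) w = pairing ξ (N.map (Int.cast : ℤ → ℝ) *ᵥ w) := by
  have h1 : ∀ (η : Fin k → ℤ) w, pairing η w = (fun i => (η i : ℝ)) ⬝ᵥ w := fun _ _ => rfl
  rw [h1, h1, Matrix.dotProduct_mulVec]
  congr 1
  funext j
  simp [Matrix.vecMul, dotProduct]

lemma IsEigen.pairing_vecMul_zpow (hA : IsEigen A b v) (hb0 : b ≠ 0) (ξ : Fin k → ℤ) (n : ℤ) :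
    pairing (ξ ᵥ* ((A ^ n : Matrix.GeneralLinearGroup (Fin k) ℤ) : Matrix (Fin k) (Fin k) ℤ)) v =
      b ^ n * pairing ξ v := by
  rw [pairing_vecMul, hA.zpow hb0 n, pairing_smul]

/-- The integer vectors orthogonal to all integer vectors that are orthogonal to `v`. -/
def rationalHull (v : Fin k → ℝ) : Submodule ℤ (Fin k → ℤ) where
  carrier := {u | ∀ η : Fin k → ℤ, pairing η v = 0 → η ⬝ᵥ u = 0}
  zero_mem' := fun η _ => dotProduct_zero η
  add_mem' := fun ha hb η hη => by rw [dotProduct_add, ha η hη, hb η hη, add_zero]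
  smul_mem' := fun c u hu η hη => by rw [dotProduct_smul, hu η hη, smul_zero]

lemma IsEigen.mulVec_mem_rationalHull (hA : IsEigen A b v) (hb0 : b ≠ 0) (n : ℤ) {u : Fin k → ℤ}
    (hu : u ∈ rationalHull v) :
    ((A ^ n : Matrix.GeneralLinearGroup (Fin k) ℤ) : Matrix (Fin k) (Fin k) ℤ) *ᵥ u ∈
      rationalHull v := by
  intro η hη
  rw [Matrix.dotProduct_mulVec]
  exact hu _ (by rw [hA.pairing_vecMul_zpow hb0, hη, mul_zero])

/-- The values ⟨ξ,v⟩ form a nonzero finitely generated subgroup of ℝ, hence a free one. A coordinate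
functional on it, pulled back to ℤᵏ, is surjective onto ℤ and kills every ξ orthogonal to `v`, so it
is the pairing with a vector of the hull. -/
lemma exists_dotProduct_eq_one (hv : v ≠ 0) :
    ∃ u ∈ rationalHull v, ∃ ζ : Fin k → ℤ, ζ ⬝ᵥ u = 1 := by
  let F : (Fin k → ℤ) →ₗ[ℤ] ℝ :=
    { toFun := fun ξ => pairing ξ v
      map_add' := fun ξ η => pairing_add ξ η v
      map_smul' := fun n ξ => by rw [pairing_zsmul]; simp }
  have hne : Nontrivial (LinearMap.range F) := by
    obtain ⟨i, hi⟩ := Function.ne_iff.1 hv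
    refine ⟨⟨0, ⟨F (Pi.single i 1), LinearMap.mem_range_self _ _⟩, fun h => hi ?_⟩⟩
    have h1 : F (Pi.single i 1) = v i := by
      simp [F, pairing, Pi.single_apply]
    rw [← h1]
    exact (congrArg Subtype.val h).symm
  let bs := Module.Free.chooseBasis ℤ (LinearMap.range F)
  obtain ⟨i⟩ := bs.index_nonempty
  let f : (Fin k → ℤ) →ₗ[ℤ] ℤ := (bs.coord i).comp F.rangeRestrict
  have hf : ∀ ξ : Fin k → ℤ, f ξ = ξ ⬝ᵥ fun j => f (Pi.single j 1) := by
    intro ξ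
    conv_lhs => rw [pi_eq_sum_univ' ξ]
    rw [map_sum, dotProduct]
    refine Finset.sum_congr rfl fun j _ => ?_
    rw [map_smul, smul_eq_mul]
  refine ⟨fun j => f (Pi.single j 1), fun η hη => ?_, ?_⟩
  · rw [← hf]
    have h2 : F.rangeRestrict η = 0 := Subtype.ext hη
    simp [f, h2]
  · obtain ⟨ζ, hζ⟩ := F.surjective_rangeRestrict (bs i)
    refine ⟨ζ, ?_⟩
    rw [← hf]
    simp [f, hζ]

/-- `S` generates the rational hull, which is invariant under all powers of A. On the hull, ξ pairs
like M·ζAⁿ even when ⟨·,v⟩ is not injective, and ζAⁿ cannot be even on all generators because it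
takes the value 1 at A⁻ⁿu₀. -/
lemma exists_odd_dotProduct (hA : IsEigen A b v) (hb0 : b ≠ 0) (hv : v ≠ 0) :
    ∃ (S : Finset (Fin k → ℤ)) (ζ : Fin k → ℤ), pairing ζ v ≠ 0 ∧
      ∀ (M : ℤ) (ξ : Fin k → ℤ) (n : ℤ), pairing ξ v = b ^ n * pairing (M • ζ) v →
        ∃ u ∈ S, ∃ c : ℤ, Odd c ∧ ξ ⬝ᵥ u = M * c := by
  obtain ⟨u₀, hu₀, ζ, hζ⟩ := exists_dotProduct_eq_one hv
  obtain ⟨S, hS⟩ := IsNoetherian.noetherian (rationalHull v)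
  refine ⟨S, ζ, fun h => by rw [hu₀ ζ h] at hζ; exact zero_ne_one hζ, fun M ξ n hξ => ?_⟩
  set N := ((A ^ n : Matrix.GeneralLinearGroup (Fin k) ℤ) : Matrix (Fin k) (Fin k) ℤ) with hN
  have hodd : ∃ u ∈ S, Odd (ζ ⬝ᵥ (N *ᵥ u)) := by
    by_contra! hcon
    have hall : ∀ u ∈ rationalHull v, (2 : ℤ) ∣ ζ ⬝ᵥ (N *ᵥ u) := by
      intro u hu
      rw [← hS] at hu
      induction hu using Submodule.span_induction with
      | mem u hu => exact even_iff_two_dvd.1 (Int.not_odd_iff_even.1 (hcon u hu))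
      | zero => simp
      | add u w _ _ h1 h2 => rw [Matrix.mulVec_add, dotProduct_add]; exact dvd_add h1 h2
      | smul c u _ h1 =>
        rw [Matrix.mulVec_smul, dotProduct_smul]; exact Dvd.dvd.mul_left h1 _
    have h1 := hall _ (hA.mulVec_mem_rationalHull hb0 (-n) hu₀)
    rw [Matrix.mulVec_mulVec, hN, ← Units.val_mul, ← zpow_add, add_neg_cancel, zpow_zero,
      Units.val_one, Matrix.one_mulVec, hζ] at h1
    norm_num at h1
  obtain ⟨u, hu, hou⟩ := hodd
  refine ⟨u, hu, _, hou, ?_⟩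
  have huL : u ∈ rationalHull v := by rw [← hS]; exact Submodule.subset_span hu
  have h1 := huL (ξ - (M • ζ) ᵥ* N) (by
    rw [pairing_sub, hξ, hN, hA.pairing_vecMul_zpow hb0, sub_self])
  rw [sub_dotProduct, sub_eq_zero] at h1
  rw [h1, ← Matrix.dotProduct_mulVec, smul_dotProduct, smul_eq_mul]

end Lattice

end SkewGraph

namespace SkewGraph

open UnitAddTorus

/-! ### Openness and density of the domination condition. -/

section Generic

variable {k : ℕ} {A : Matrix.GeneralLinearGroup (Fin k) ℤ} {b : ℝ} {v : Fin k → ℝ}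

/-- The Fourier coefficients of a real function on the torus. -/
noncomputable def coeff (p : UnitAddTorus (Fin k) → ℝ) : (Fin k → ℤ) → ℂ :=
  mFourierCoeff fun x => (p x : ℂ)

/-- The functions having a Fourier coefficient that dominates the other coefficients in its orbit. -/
def dominatedSet (k : ℕ) (b : ℝ) (v : Fin k → ℝ) : Set (CrTorus k (k + 1)) :=
  {p | ∃ ξ₀, pairing ξ₀ v ≠ 0 ∧
    ∑' ξ, orbitWeight b v ξ₀ ξ * ‖coeff p.1 ξ‖ < ‖coeff p.1 ξ₀‖}

lemma CrTorus.hasFourier (p : CrTorus k (k + 1)) : HasFourier p.1 (coeff p.1) := by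
  obtain ⟨C, hC, h⟩ := exists_bound_iteratedFDeriv p.2
  exact hasFourier_of_contDiff p.2 hC h

lemma embeddingConst_nonneg (k : ℕ) : 0 ≤ embeddingConst k :=
  div_nonneg (add_nonneg (tsum_nonneg fun ξ => by positivity) (by positivity)) zero_le_two

lemma CrTorus.summable_coeff_sub {p q : CrTorus k (k + 1)} {δ : ℝ} (hδ : 0 < δ)
    (hpq : ∀ m ≤ k + 1, ∀ x,
      ‖iteratedFDeriv ℝ m (torusLift p.1) x - iteratedFDeriv ℝ m (torusLift q.1) x‖ < δ) :
    Summable (fun ξ => (1 + ‖ξ‖) * ‖coeff p.1 ξ - coeff q.1 ξ‖) ∧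
      ∑' ξ, (1 + ‖ξ‖) * ‖coeff p.1 ξ - coeff q.1 ξ‖ ≤ embeddingConst k * δ := by
  have hp := p.2
  have hq := q.2
  have h1 : ∀ m ≤ k + 1, ∀ x, ‖iteratedFDeriv ℝ m
      (fun x : Fin k → ℝ => (fun y => p.1 y - q.1 y) (toTorus x)) x‖ ≤ δ := by
    intro m hm x
    have hm' : ((m : ℕ) : WithTop ℕ∞) ≤ (k + 1 : ℕ) := by exact_mod_cast hm
    have h2 := iteratedFDeriv_sub_apply (𝕜 := ℝ) (x := x) (hp.of_le hm').contDiffAt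
      (hq.of_le hm').contDiffAt
    exact (congrArg norm h2).le.trans (hpq m hm x).le
  have h3 := summable_weighted_mFourierCoeff (p := fun y => p.1 y - q.1 y) (hp.sub hq) hδ h1
  have h4 : ∀ ξ, mFourierCoeff (fun x => ((p.1 x - q.1 x : ℝ) : ℂ)) ξ = coeff p.1 ξ - coeff q.1 ξ := by
    intro ξ
    have h5 := mFourierCoeff_sub (f := fun x => ((p.1 x : ℝ) : ℂ)) (g := fun x => ((q.1 x : ℝ) : ℂ))
      (Complex.continuous_ofReal.comp (continuous_of_contDiff_lift hp))
      (Complex.continuous_ofReal.comp (continuous_of_contDiff_lift hq)) ξ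
    rw [coeff, coeff, ← h5]
    simp only [Complex.ofReal_sub]
  simpa only [h4] using h3

lemma isOpen_dominatedSet : IsOpen (dominatedSet k b v) := by
  rw [isOpen_iff_mem_nhds]
  rintro q ⟨ξ₀, hξ₀, hq⟩
  set C : ℝ := 1 + (∑ i, |v i|) / |pairing ξ₀ v| with hC
  have hC0 : 0 < C := by
    have : 0 ≤ (∑ i, |v i|) / |pairing ξ₀ v| :=
      div_nonneg (Finset.sum_nonneg fun i _ => abs_nonneg _) (abs_nonneg _)
    linarith
  set K : ℝ := embeddingConst k + 1 with hK
  have hK0 : 0 < K := by linarith [embeddingConst_nonneg k]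
  set κ := ‖coeff q.1 ξ₀‖ - ∑' ξ, orbitWeight b v ξ₀ ξ * ‖coeff q.1 ξ‖ with hκ
  have hκ0 : 0 < κ := sub_pos.2 hq
  -- The coefficient at ξ₀ moves by at most Kδ and the orbit sum by at most CKδ, together at most
  -- half of the gap κ.
  set δ := κ / (2 * ((C + 1) * K)) with hδ
  have hδ0 : 0 < δ := by positivity
  filter_upwards [eventually_norm_iteratedFDeriv_sub_lt q hδ0] with p hp
  obtain ⟨hs, ht⟩ := CrTorus.summable_coeff_sub hδ0 hp
  have ht' : ∑' ξ, (1 + ‖ξ‖) * ‖coeff p.1 ξ - coeff q.1 ξ‖ ≤ K * δ :=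
    ht.trans (by rw [hK]; nlinarith)
  refine ⟨ξ₀, hξ₀, ?_⟩
  have h1 : ‖coeff p.1 ξ₀ - coeff q.1 ξ₀‖ ≤ K * δ := by
    refine le_trans ?_ ((hs.le_tsum ξ₀ fun ξ _ => by positivity).trans ht')
    nlinarith [norm_nonneg ξ₀, norm_nonneg (coeff p.1 ξ₀ - coeff q.1 ξ₀),
      mul_nonneg (norm_nonneg ξ₀) (norm_nonneg (coeff p.1 ξ₀ - coeff q.1 ξ₀))]
  have h2 : ∑' ξ, orbitWeight b v ξ₀ ξ * ‖coeff p.1 ξ‖ ≤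
      ∑' ξ, orbitWeight b v ξ₀ ξ * ‖coeff q.1 ξ‖ + C * (K * δ) := by
    have h3 := q.hasFourier.summable_orbitWeight (b := b) (v := v) ξ₀
    have h4 := h3.add (hs.mul_left C)
    calc _ ≤ ∑' ξ, (orbitWeight b v ξ₀ ξ * ‖coeff q.1 ξ‖ +
          C * ((1 + ‖ξ‖) * ‖coeff p.1 ξ - coeff q.1 ξ‖)) := by
          refine (p.hasFourier.summable_orbitWeight ξ₀).tsum_le_tsum (fun ξ => ?_) h4
          have h5 := orbitWeight_le (b := b) (v := v) ξ₀ ξ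
          have h6 := orbitWeight_nonneg (b := b) (v := v) ξ₀ ξ
          have h7 : ‖coeff p.1 ξ‖ ≤ ‖coeff q.1 ξ‖ + ‖coeff p.1 ξ - coeff q.1 ξ‖ := by
            have := norm_add_le (coeff q.1 ξ) (coeff p.1 ξ - coeff q.1 ξ)
            rwa [add_sub_cancel] at this
          calc _ ≤ orbitWeight b v ξ₀ ξ * (‖coeff q.1 ξ‖ + ‖coeff p.1 ξ - coeff q.1 ξ‖) := by gcongr
            _ = orbitWeight b v ξ₀ ξ * ‖coeff q.1 ξ‖ +
                orbitWeight b v ξ₀ ξ * ‖coeff p.1 ξ - coeff q.1 ξ‖ := by ring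
            _ ≤ orbitWeight b v ξ₀ ξ * ‖coeff q.1 ξ‖ +
                (C * (1 + ‖ξ‖)) * ‖coeff p.1 ξ - coeff q.1 ξ‖ := by gcongr
            _ = _ := by ring
      _ = ∑' ξ, orbitWeight b v ξ₀ ξ * ‖coeff q.1 ξ‖ +
          C * ∑' ξ, (1 + ‖ξ‖) * ‖coeff p.1 ξ - coeff q.1 ξ‖ := by
        rw [h3.tsum_add (hs.mul_left C), tsum_mul_left]
      _ ≤ _ := by gcongr
  have h8 : ‖coeff q.1 ξ₀‖ ≤ ‖coeff p.1 ξ₀‖ + ‖coeff p.1 ξ₀ - coeff q.1 ξ₀‖ := by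
    have := norm_sub_le (coeff p.1 ξ₀) (coeff p.1 ξ₀ - coeff q.1 ξ₀)
    rwa [sub_sub_cancel] at this
  have h9 : (C + 1) * (K * δ) = κ / 2 := by rw [hδ]; field_simp
  nlinarith

/-- The vector `(2M)⁻¹ ∑_{u ∈ J} u`. -/
noncomputable def smallShift (M : ℝ) (J : Finset (Fin k → ℤ)) : Fin k → ℝ :=
  (2 * M)⁻¹ • ∑ u ∈ J, fun i => (u i : ℝ)

lemma mFourier_smallShift (M : ℝ) (J : Finset (Fin k → ℤ)) (ξ : Fin k → ℤ) :
    mFourier ξ (toTorus (smallShift M J)) = ∏ u ∈ J, unitExp ((2 * M)⁻¹ * (ξ ⬝ᵥ u : ℤ)) := by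
  classical
  rw [mFourier_toTorus, smallShift, pairing_smul]
  induction J using Finset.induction_on with
  | empty => simp [pairing, unitExp_zero]
  | insert u J hu ih =>
    rw [Finset.sum_insert hu, Finset.prod_insert hu, ← ih, ← unitExp_add, ← pairing_intCast]
    congr 1
    simp only [pairing, Pi.add_apply, mul_add, Finset.sum_add_distrib]

lemma tendsto_smallShift (J : Finset (Fin k → ℤ)) :
    Tendsto (fun M : ℕ => smallShift (M : ℝ) J) atTop (𝓝 0) := by
  have h1 : Tendsto (fun M : ℕ => (2 * (M : ℝ))⁻¹) atTop (𝓝 0) :=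
    tendsto_inv_atTop_zero.comp (tendsto_natCast_atTop_atTop.const_mul_atTop two_pos)
  simpa [smallShift] using h1.smul_const (∑ u ∈ J, fun i => ((u i : ℤ) : ℝ))

/-- The average of the translates of `p` by the vectors `smallShift M J`, for `J ⊆ S`. -/
noncomputable def average (S : Finset (Fin k → ℤ)) (M : ℝ) (p : UnitAddTorus (Fin k) → ℝ)
    (x : UnitAddTorus (Fin k)) : ℝ :=
  ∑ J ∈ S.powerset, ((2 : ℝ) ^ S.card)⁻¹ * p (x + toTorus (smallShift M J))

/-- The sum over subsets J factorises over u ∈ S. For M ≠ 0, the factor of u is zero precisely when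
ξ·u is an odd multiple of M. -/
lemma coeff_average (S : Finset (Fin k → ℤ)) (M : ℝ) {p : UnitAddTorus (Fin k) → ℝ}
    (hp : Continuous p) (ξ : Fin k → ℤ) :
    coeff (average S M p) ξ = ((2 : ℂ) ^ S.card)⁻¹ *
      (∏ u ∈ S, (1 + unitExp ((2 * M)⁻¹ * (ξ ⬝ᵥ u : ℤ)))) * coeff p ξ := by
  simp only [coeff, average, Complex.ofReal_sum, Complex.ofReal_mul, Complex.ofReal_inv,
    Complex.ofReal_pow, Complex.ofReal_ofNat]
  rw [mFourierCoeff_sum _ fun J _ => by fun_prop, Finset.prod_one_add, Finset.mul_sum, Finset.sum_mul]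
  refine Finset.sum_congr rfl fun J _ => ?_
  rw [mFourierCoeff_const_mul, mFourierCoeff_translate (fun x => (p x : ℂ)), mFourier_smallShift,
    mul_assoc]

lemma contDiff_average {r : ℕ} (S : Finset (Fin k → ℤ)) (M : ℝ) {p : UnitAddTorus (Fin k) → ℝ}
    (hp : ContDiff ℝ r (torusLift p)) : ContDiff ℝ r (torusLift (average S M p)) := by
  have h : torusLift (average S M p) = fun x => ∑ J ∈ S.powerset, ((2 : ℝ) ^ S.card)⁻¹ *
      torusLift p (x + smallShift M J) := by
    funext x
    simp only [torusLift, average, toTorus_add]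
  rw [h]
  exact ContDiff.sum fun J _ => contDiff_const.mul (hp.comp (contDiff_id.add contDiff_const))

lemma iteratedFDeriv_average {r m : ℕ} (hm : m ≤ r) (S : Finset (Fin k → ℤ)) (M : ℝ)
    {p : UnitAddTorus (Fin k) → ℝ} (hp : ContDiff ℝ r (torusLift p)) (x : Fin k → ℝ) :
    iteratedFDeriv ℝ m (torusLift (average S M p)) x = ∑ J ∈ S.powerset, ((2 : ℝ) ^ S.card)⁻¹ •
      iteratedFDeriv ℝ m (torusLift p) (x + smallShift M J) := by
  have hm' : ((m : ℕ) : WithTop ℕ∞) ≤ (r : ℕ) := by exact_mod_cast hm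
  have h : torusLift (average S M p) = fun x => ∑ J ∈ S.powerset,
      (((2 : ℝ) ^ S.card)⁻¹ • fun x => torusLift p (x + smallShift M J)) x := by
    funext x
    simp only [torusLift, average, toTorus_add, Pi.smul_apply, smul_eq_mul]
  have hc : ∀ J, ContDiff ℝ m fun x => torusLift p (x + smallShift M J) := fun J =>
    (hp.of_le hm').comp (contDiff_id.add contDiff_const)
  have hsum := iteratedFDeriv_sum (𝕜 := ℝ) (i := m) (u := S.powerset)
    (f := fun J => ((2 : ℝ) ^ S.card)⁻¹ • fun x => torusLift p (x + smallShift M J))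
    fun J _ => (hc J).const_smul ((2 : ℝ) ^ S.card)⁻¹
  rw [h, hsum, Finset.sum_apply]
  refine Finset.sum_congr rfl fun J _ => ?_
  rw [iteratedFDeriv_const_smul_apply (hc J).contDiffAt, iteratedFDeriv_comp_add_right]

lemma eventually_norm_iteratedFDeriv_average_sub_lt {r : ℕ} (S : Finset (Fin k → ℤ))
    {p : UnitAddTorus (Fin k) → ℝ} (hp : ContDiff ℝ r (torusLift p)) {δ : ℝ} (hδ : 0 < δ) :
    ∀ᶠ M : ℕ in atTop, ∀ m ≤ r, ∀ x,
      ‖iteratedFDeriv ℝ m (torusLift (average S M p)) x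
        - iteratedFDeriv ℝ m (torusLift p) x‖ ≤ δ := by
  have h1 : ∀ᶠ M : ℕ in atTop, ∀ J ∈ S.powerset, ∀ m ≤ r, ∀ x,
      ‖iteratedFDeriv ℝ m (torusLift p) (x + smallShift M J)
        - iteratedFDeriv ℝ m (torusLift p) x‖ < δ := by
    rw [Filter.eventually_all_finset]
    exact fun J _ => (tendsto_smallShift J).eventually
      (eventually_norm_iteratedFDeriv_translate_sub_lt hp hδ)
  filter_upwards [h1] with M hM m hm x
  have h2 : (0 : ℝ) < 2 ^ S.card := by positivity
  have h3 : iteratedFDeriv ℝ m (torusLift p) x = ∑ J ∈ S.powerset, ((2 : ℝ) ^ S.card)⁻¹ •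
      iteratedFDeriv ℝ m (torusLift p) x := by
    rw [Finset.sum_const, Finset.card_powerset, ← Nat.cast_smul_eq_nsmul ℝ, smul_smul]
    push_cast
    rw [mul_inv_cancel₀ h2.ne', one_smul]
  rw [iteratedFDeriv_average hm S M hp, h3, ← Finset.sum_sub_distrib]
  refine (norm_sum_le _ _).trans ?_
  calc _ ≤ ∑ J ∈ S.powerset, ((2 : ℝ) ^ S.card)⁻¹ * δ := by
        refine Finset.sum_le_sum fun J hJ => ?_
        rw [← smul_sub, norm_smul, Real.norm_eq_abs, abs_of_pos (inv_pos.2 h2)]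
        exact mul_le_mul_of_nonneg_left (hM J hJ m hm x).le (inv_pos.2 h2).le
    _ = δ := by
      rw [Finset.sum_const, Finset.card_powerset, nsmul_eq_mul]
      push_cast
      field_simp

/-- The real part of the character `ξ`. -/
noncomputable def reChar (ξ : Fin k → ℤ) (x : UnitAddTorus (Fin k)) : ℝ := (mFourier ξ x).re

lemma contDiff_reChar (ξ : Fin k → ℤ) (r : ℕ) : ContDiff ℝ r (torusLift (reChar ξ)) := by
  have h : torusLift (reChar ξ) = fun x => Real.cos (2 * Real.pi * ∑ i, (ξ i : ℝ) * x i) := by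
    funext x
    rw [torusLift, reChar, mFourier_toTorus, unitExp, mul_comm, Complex.exp_ofReal_mul_I_re, pairing]
  rw [h]
  fun_prop

lemma coeff_reChar (ξ η : Fin k → ℤ) :
    coeff (reChar ξ) η = ((if η = ξ then 1 else 0) + if η = -ξ then 1 else 0) / 2 := by
  have h : ∀ x, ((reChar ξ x : ℝ) : ℂ) = 1 / 2 * (mFourier ξ x + mFourier (-ξ) x) := by
    intro x
    rw [reChar, Complex.re_eq_add_conj, mFourier_neg]
    ring
  simp only [coeff, h]
  rw [mFourierCoeff_const_mul, mFourierCoeff_add (mFourier ξ).continuous (mFourier (-ξ)).continuous,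
    mFourierCoeff_mFourier, mFourierCoeff_mFourier]
  ring

/-- For large M the average is Cᵏ⁺¹-close to `q`, yet has no coefficients on the orbit of Mζ. A
small cosine of frequency Mζ is then the only contribution there. -/
lemma dense_dominatedSet (hA : IsEigen A b v) (hb0 : b ≠ 0) (hb1 : |b| < 1) (hv : v ≠ 0) :
    Dense (dominatedSet k b v) := by
  intro q
  rw [mem_closure_iff_nhds]
  intro s hs
  obtain ⟨δ, hδ, hsδ⟩ := exists_mem_of_mem_nhds_crTorus hs
  obtain ⟨S, ζ, hζ, hS⟩ := exists_odd_dotProduct hA hb0 hv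
  obtain ⟨M, hM, hM0⟩ := ((eventually_norm_iteratedFDeriv_average_sub_lt S q.2
    (half_pos (half_pos hδ))).and (eventually_gt_atTop 0)).exists
  have hMr : (M : ℝ) ≠ 0 := by exact_mod_cast hM0.ne'
  set ξ₀ : Fin k → ℤ := (M : ℤ) • ζ with hξ₀
  have hw : pairing ξ₀ v ≠ 0 := by
    rw [hξ₀, pairing_zsmul]
    exact mul_ne_zero (by exact_mod_cast hM0.ne') hζ
  obtain ⟨C, hC, hCb⟩ := exists_bound_iteratedFDeriv (contDiff_reChar ξ₀ (k + 1))
  -- The cosine and the averaging each change derivatives by at most δ/4.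
  set c : ℝ := δ / (4 * C) with hc
  have hc0 : 0 < c := by positivity
  have hcont := continuous_of_contDiff_lift q.2
  have havg := contDiff_average S M q.2
  have hre := contDiff_reChar ξ₀ (k + 1)
  let p : CrTorus k (k + 1) := ⟨fun x => average S M q.1 x + c * reChar ξ₀ x,
    havg.add (contDiff_const.mul hre)⟩
  have hcoeff : ∀ ξ, coeff p.1 ξ = coeff (average S M q.1) ξ + c * coeff (reChar ξ₀) ξ := by
    intro ξ
    have h1 : Continuous fun x => ((average S M q.1 x : ℝ) : ℂ) :=
      Complex.continuous_ofReal.comp (continuous_of_contDiff_lift havg)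
    have h2 : Continuous fun x => (c : ℂ) * ((reChar ξ₀ x : ℝ) : ℂ) :=
      continuous_const.mul (Complex.continuous_ofReal.comp (continuous_of_contDiff_lift hre))
    rw [coeff, coeff, coeff, ← mFourierCoeff_const_mul, ← mFourierCoeff_add h1 h2]
    simp only [p, Complex.ofReal_add, Complex.ofReal_mul]
  have hvanish : ∀ (ξ : Fin k → ℤ) (n : ℤ), pairing ξ v = b ^ n * pairing ξ₀ v →
      coeff (average S M q.1) ξ = 0 := by
    intro ξ n hn
    obtain ⟨u, hu, c', ⟨d, rfl⟩, hd⟩ := hS M ξ n hn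
    rw [coeff_average S M hcont, Finset.prod_eq_zero hu, mul_zero, zero_mul]
    rw [hd]
    have h1 : (2 * (M : ℝ))⁻¹ * (((M : ℤ) * (2 * d + 1) : ℤ) : ℝ) = d + 1 / 2 := by
      push_cast; field_simp
    rw [h1, unitExp_add, unitExp_intCast, unitExp_half]
    norm_num
  refine ⟨p, hsδ p fun m hm x => ?_, ξ₀, hw, ?_⟩
  · have hm' : ((m : ℕ) : WithTop ℕ∞) ≤ (k + 1 : ℕ) := by exact_mod_cast hm
    have h1 : torusLift p.1 = torusLift (average S M q.1) + c • torusLift (reChar ξ₀) := by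
      funext x; rfl
    have hcre : ContDiff ℝ m (c • torusLift (reChar ξ₀)) := (hre.of_le hm').const_smul c
    rw [h1, iteratedFDeriv_add_apply (havg.of_le hm').contDiffAt hcre.contDiffAt,
      iteratedFDeriv_const_smul_apply (hre.of_le hm').contDiffAt, add_sub_right_comm]
    refine (norm_add_le _ _).trans_lt ?_
    rw [norm_smul, Real.norm_eq_abs, abs_of_pos hc0]
    have h2 := hM m hm x
    have h3 : c * ‖iteratedFDeriv ℝ m (torusLift (reChar ξ₀)) x‖ ≤ c * C := by
      gcongr; exact hCb m hm x
    have h4 : c * C = δ / 4 := by rw [hc]; field_simp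
    linarith
  · have h1 : ∀ ξ, orbitWeight b v ξ₀ ξ * ‖coeff p.1 ξ‖ = 0 := by
      intro ξ
      unfold orbitWeight
      split_ifs with h
      swap
      · exact zero_mul _
      obtain ⟨hne, n, hn⟩ := h
      -- A real cosine also has a coefficient at −ξ₀; it lies off the orbit, since bⁿ = −1 is
      -- impossible for 0 < |b| < 1.
      have h2 : ξ ≠ -ξ₀ := by
        rintro rfl
        rw [pairing_neg, neg_eq_neg_one_mul] at hn
        have h3 : b ^ n = -1 := (mul_right_cancel₀ hw hn).symm
        have h4 : b ^ (n + n) = b ^ (0 : ℤ) := by rw [zpow_add₀ hb0, h3]; norm_num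
        have h5 := zpow_injective_of_abs_lt_one hb0 hb1 h4
        have h6 : n = 0 := by omega
        rw [h6] at h3
        norm_num at h3
      rw [hcoeff, hvanish ξ n hn, coeff_reChar, if_neg hne, if_neg h2]
      simp
    have h2 : ξ₀ ≠ -ξ₀ := by
      intro h
      have h3 := congrArg (fun ξ => pairing ξ v) h
      simp only [pairing_neg] at h3
      exact hw (by linarith)
    simp only [h1, tsum_zero]
    rw [hcoeff, hvanish ξ₀ 0 (by simp), coeff_reChar, if_pos rfl, if_neg h2, norm_pos_iff]
    have : (c : ℂ) ≠ 0 := by exact_mod_cast hc0.ne'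
    simpa using this

end Generic

end SkewGraph

/-! ### Assembling the directions. -/

theorem mainTheorem6 (k : ℕ) (A : Matrix.GeneralLinearGroup (Fin k) ℤ)
    (B : Fin k → ℝ) (v : Module.Basis (Fin k) ℝ (Fin k → ℝ))
    (hv : ∀ i, (A : Matrix (Fin k) (Fin k) ℤ).map (Int.cast : ℤ → ℝ) *ᵥ v i = B i • v i)
    (hB : StrictMono fun i => |B i|)
    (j : ℕ) (hj : j ≤ k)
    (hstable : ∀ i : Fin k, (i : ℕ) < j → |B i| < 1)
    (hunstable : ∀ i : Fin k, j ≤ (i : ℕ) → 1 < |B i|) :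
    ∃ U : Set (SkewGraph.CrTorus k (k + 1)), IsOpen U ∧ Dense U ∧
      ∀ p ∈ U, ∀ l : ℕ, l ≤ j → ∀ lam : ℝ, 0 < lam → lam < 1 →
        (∀ i : Fin k, (i : ℕ) + 1 = l → |B i| < lam) →
        (∀ i : Fin k, (i : ℕ) = l → lam < |B i|) →
        ∀ x : UnitAddTorus (Fin k), ∀ ε : ℝ, 0 < ε →
          ∃ d : Fin k → ℝ,
            (∀ i, SkewGraph.HasBoxDim
              (SkewGraph.planeGraph (Set.Icc (-ε) ε) (SkewGraph.subSlice A lam p.1 x (v i)))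
              (d i)) ∧
            ∑ i, d i = ((k : ℝ) - l) + 2 * l
              - ∑ i ∈ Finset.univ.filter (fun i : Fin k => (i : ℕ) < l),
                  Real.log lam / Real.log |B i| := by
  have hE : ∀ i, SkewGraph.IsEigen A (B i) (v i) := hv
  have hv0 : ∀ i, v i ≠ 0 := v.ne_zero
  have hb0 : ∀ i, B i ≠ 0 := fun i => (hE i).ne_zero (hv0 i)
  have hgen : ∀ s : Finset (Fin k), (∀ i ∈ s, |B i| < 1) →
      IsOpen (⋂ i ∈ s, SkewGraph.dominatedSet k (B i) (v i)) ∧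
      Dense (⋂ i ∈ s, SkewGraph.dominatedSet k (B i) (v i)) := by
    intro s
    induction s using Finset.induction_on with
    | empty => simp
    | insert i s hi ih =>
      intro hs
      obtain ⟨h1, h2⟩ := ih fun i' hi' => hs i' (Finset.mem_insert_of_mem hi')
      rw [Finset.set_biInter_insert]
      exact ⟨SkewGraph.isOpen_dominatedSet.inter h1,
        (SkewGraph.dense_dominatedSet (hE i) (hb0 i) (hs i (Finset.mem_insert_self i s))
          (hv0 i)).inter_of_isOpen_left h2 SkewGraph.isOpen_dominatedSet⟩
  obtain ⟨hopen, hdense⟩ := hgen (Finset.univ.filter fun i : Fin k => (i : ℕ) < j)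
    fun i hi => hstable i (Finset.mem_filter.1 hi).2
  refine ⟨_, hopen, hdense, fun p hp l hl lam hlam0 hlam1 hlow hhigh x ε hε => ?_⟩
  -- Indices start at 0, so λ lies between the moduli at l − 1 and l where these exist; monotonicity
  -- extends the comparison to all indices.
  have hlt : ∀ i : Fin k, (i : ℕ) < l → |B i| < lam := by
    intro i hi
    refine lt_of_le_of_lt (hB.monotone ?_) (hlow ⟨l - 1, by omega⟩ (by simp; omega))
    rw [Fin.le_def]; simp; omega
  have hgt : ∀ i : Fin k, ¬(i : ℕ) < l → lam < |B i| := by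
    intro i hi
    refine lt_of_lt_of_le (hhigh ⟨l, by omega⟩ rfl) (hB.monotone ?_)
    rw [Fin.le_def]; simp; omega
  refine ⟨fun i => if (i : ℕ) < l then 2 - Real.log lam / Real.log |B i| else 1, fun i => ?_, ?_⟩
  · obtain ⟨P, L, hL⟩ := p.hasFourier.lineLipschitz (v i)
    by_cases hi : (i : ℕ) < l
    · simp only [hi, ↓reduceIte]
      obtain ⟨ξ₀, hξ₀, hdom⟩ := Set.mem_iInter₂.1 hp i (Finset.mem_filter.2
        ⟨Finset.mem_univ i, hi.trans_le hl⟩)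
      exact hL.hasBoxDim_of_twoSided_ne_zero (hE i) (hb0 i) hlam0 hlam1 (hlt i hi)
        (p.hasFourier.exists_twoSided_ne_zero (hE i) (hb0 i) hlam0 hlam1 (hlt i hi) hξ₀ hdom) x hε
    · simp only [hi, ↓reduceIte]
      exact hL.hasBoxDim_one (hE i) hlam0 hlam1 (hgt i hi) x hε
  · have h1 : ∀ i : Fin k, (if (i : ℕ) < l then 2 - Real.log lam / Real.log |B i| else 1) =
        1 + ((if (i : ℕ) < l then 1 else 0) -
          if (i : ℕ) < l then Real.log lam / Real.log |B i| else 0) := by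
      intro i; split_ifs <;> ring
    have hcard : (Finset.univ.filter fun i : Fin k => (i : ℕ) < l).card = l := by
      rw [Fin.card_filter_val_lt, min_eq_right (hl.trans hj)]
    simp only [h1, Finset.sum_add_distrib, Finset.sum_sub_distrib]
    rw [Finset.sum_boole, hcard, ← Finset.sum_filter]
    simp
    ring
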